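/- Let $n\ge 2$ and let $\Omega\subset\mathbb R^n$ be a bounded Lipschitz domain (bounded, open, connected, and near every boundary point, in suitable orthogonal coordinates, the region on one side of the graph of a Lipschitz function). All function spaces are complex-valued. Let $L^2_\diamond(\partial\Omega)$ be the space of $g\in L^2(\partial\Omega)$ with $\int_{\partial\Omega} g\,ds=0$, and let $H^1_\diamond(\Omega)$ be the space of $u\in H^1(\Omega)$ whose trace $u|_{\partial\Omega}$ lies in $L^2_\diamond(\partial\Omega)$. Let $\gamma:\Omega\to\mathbb C$ be an admittivity, i.e. $\operatorname{Re}\gamma,\operatorname{Im}\gamma\in L^\infty(\Omega;\mathbb R)$ and $\operatorname{ess\,inf}_\Omega\operatorname{Re}\gamma>0$. For $g\in L^2_\diamond(\partial\Omega)$ let $u_\gamma^{(g)}\in H^1_\diamond(\Omega)$ be the weak solution of $$\nabla\cdot(\gamma\nabla u_\gamma^{(g)})=0\ \text{ in }\Omega,\qquad \gamma\,\partial_\nu u_\gamma^{(g)}|_{\partial\Omega}=g,$$ that is, $\int_\Omega\gamma\nabla u_\gamma^{(g)}\cdot\nabla v\,dx=\int_{\partial\Omega} g\,v|_{\partial\Omega}\,ds$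 for all $v\in H^1(\Omega)$. Let $\Lambda(\gamma):L^2_\diamond(\partial\Omega)\to L^2_\diamond(\partial\Omega)$, $g\mapsto u_\gamma^{(g)}|_{\partial\Omega}$, be the (bounded linear) Neumann-to-Dirichlet operator. For a bounded linear operator $A$ on $L^2_\diamond(\partial\Omega)$ write $\operatorname{Re}(A)=\tfrac12(A+A^*)$, with $A^*$ the adjoint of $A$. Let $\gamma_1,\gamma_2$ be two such admittivities and let $g\in L^2_\diamond(\partial\Omega)$. Then, with $u_2=u_{\gamma_2}^{(g)}$, $$\int_\Omega\Big(\frac{\operatorname{Re}\gamma_2}{\operatorname{Re}\gamma_1}\operatorname{Re}(\gamma_1-\gamma_2)-\frac{(\operatorname{Im}\gamma_2)^2}{\operatorname{Re}\gamma_1}\Big)|\nabla u_2|^2\,dx\ \le\ \int_{\partial\Omega}\overline g\,\operatorname{Re}\big[\Lambda(\gamma_2)-\Lambda(\gamma_1)\big]g\,ds\ \le\ \int_\Omega\Big(\operatorname{Re}(\gamma_1-\gamma_2)+\frac{(\operatorname{Im}\gamma_1)^2}{\operatorname{Re}\gamma_1}\Big)|\nabla u_2|^2\,dx ,$$ where in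 particular the middle term is real. -/

import Mathlib

open MeasureTheory Filter Topology
open scoped ENNReal NNReal ContDiff ComplexOrder

namespace EIT

noncomputable section

/-- A bounded Lipschitz domain in `ℝⁿ`: a bounded, connected, nonempty open set which, near each of
its boundary points `p`, is the region below the graph of a Lipschitz function, in the orthogonal
coordinates `x = x' + ⟪e, x⟫ e` (with `x' ⊥ e`) given by some unit vector `e`. -/
structure LipschitzDomain (n : ℕ) where
  carrier : Set (EuclideanSpace ℝ (Fin n))
  isOpen : IsOpen carrier
  isConnected : IsConnected carrier
  isBounded : Bornology.IsBounded carrier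
  locally_graph : ∀ p ∈ frontier carrier, ∃ e : EuclideanSpace ℝ (Fin n), ‖e‖ = 1 ∧
    ∃ (K : ℝ≥0) (f : EuclideanSpace ℝ (Fin n) → ℝ), LipschitzWith K f ∧
      ∃ r > 0, ∀ x ∈ Metric.ball p r,
        (x ∈ carrier ↔ inner ℝ e x < f (x - (inner ℝ e x) • e))

variable {n : ℕ}

/-- Lebesgue measure on `Ω`. -/
abbrev LipschitzDomain.vol (Ω : LipschitzDomain n) : Measure (EuclideanSpace ℝ (Fin n)) :=
  volume.restrict Ω.carrier

/-- Surface measure `ds` on `∂Ω`: the `(n-1)`-dimensional Hausdorff measure, normalized to agree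
with Lebesgue measure on `ℝⁿ⁻¹`. -/
abbrev LipschitzDomain.surf (Ω : LipschitzDomain n) : Measure (EuclideanSpace ℝ (Fin n)) :=
  (μHE[n - 1]).restrict (frontier Ω.carrier)

/-- Near a boundary point, the boundary lies on the graph. -/
theorem LipschitzDomain.graph_eq (Ω : LipschitzDomain n) {p e : EuclideanSpace ℝ (Fin n)}
    {K : ℝ≥0} {f : EuclideanSpace ℝ (Fin n) → ℝ} (hf : LipschitzWith K f) {r : ℝ}
    (h : ∀ x ∈ Metric.ball p r,
      (x ∈ Ω.carrier ↔ inner ℝ e x < f (x - (inner ℝ e x) • e)))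
    {x : EuclideanSpace ℝ (Fin n)} (hx : x ∈ frontier Ω.carrier) (hxp : x ∈ Metric.ball p r) :
    inner ℝ e x = f (x - (inner ℝ e x) • e) := by
  have hxΩ : x ∉ Ω.carrier := by
    rw [Ω.isOpen.frontier_eq] at hx
    exact hx.2
  apply le_antisymm
  · by_contra! hlt
    have hc : Continuous fun y : EuclideanSpace ℝ (Fin n) => f (y - (inner ℝ e y) • e) :=
      hf.continuous.comp (by fun_prop)
    have ho : IsOpen {y : EuclideanSpace ℝ (Fin n) | f (y - (inner ℝ e y) • e) < inner ℝ e y} :=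
      isOpen_lt hc (by fun_prop)
    have hcl := frontier_subset_closure hx
    obtain ⟨y, ⟨hy1, hy2⟩, hyΩ⟩ :=
      mem_closure_iff.1 hcl _ (ho.inter Metric.isOpen_ball) ⟨hlt, hxp⟩
    exact absurd ((h y hy2).1 hyΩ) (not_lt.2 (le_of_lt hy1))
  · by_contra! hlt
    exact hxΩ ((h x hxp).2 hlt)

/-- Bounded pieces of a hyperplane have finite `(n-1)`-dimensional measure. -/
theorem hyperplane_measure_lt_top {e : EuclideanSpace ℝ (Fin n)} (he : ‖e‖ = 1) (R : ℝ) :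
    μHE[n - 1] (((ℝ ∙ e)ᗮ : Set (EuclideanSpace ℝ (Fin n))) ∩ Metric.closedBall 0 R) < ⊤ := by
  have hrank : Module.finrank ℝ (ℝ ∙ e)ᗮ = n - 1 := by
    have h0 : e ≠ 0 := by
      intro h
      simp [h] at he
    have h1 := (ℝ ∙ e).finrank_add_finrank_orthogonal
    rw [finrank_span_singleton h0, finrank_euclideanSpace_fin] at h1
    omega
  have hset : ((ℝ ∙ e)ᗮ : Set (EuclideanSpace ℝ (Fin n))) ∩ Metric.closedBall 0 R
      = (Subtype.val : (ℝ ∙ e)ᗮ → EuclideanSpace ℝ (Fin n)) '' Metric.closedBall 0 R := by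
    ext x
    simp only [Set.mem_inter_iff, Set.mem_image, SetLike.mem_coe, Metric.mem_closedBall,
      dist_zero_right]
    constructor
    · rintro ⟨hx, hR⟩
      exact ⟨⟨x, hx⟩, by simpa using hR, rfl⟩
    · rintro ⟨y, hy, rfl⟩
      exact ⟨y.2, by simpa using hy⟩
  rw [hset, isometry_subtype_coe.euclideanHausdorffMeasure_image, ← hrank,
    InnerProductSpace.euclideanHausdorffMeasure_eq_volume]
  exact (isCompact_closedBall _ _).measure_lt_top

/-- The boundary of a bounded Lipschitz domain has finite surface measure. -/
instance LipschitzDomain.isFiniteMeasure_surf (Ω : LipschitzDomain n) :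
    IsFiniteMeasure Ω.surf := by
  constructor
  rw [Measure.restrict_apply_univ]
  have hcomp : IsCompact (frontier Ω.carrier) :=
    Metric.isCompact_of_isClosed_isBounded isClosed_frontier
      (Ω.isBounded.closure.subset frontier_subset_closure)
  refine hcomp.measure_lt_top_of_nhdsWithin fun p hp => ?_
  obtain ⟨e, he, K, f, hf, r, hr, h⟩ := Ω.locally_graph p hp
  refine ⟨frontier Ω.carrier ∩ Metric.ball p r, inter_mem self_mem_nhdsWithin
    (mem_nhdsWithin_of_mem_nhds (Metric.ball_mem_nhds p hr)), ?_⟩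
  set F : EuclideanSpace ℝ (Fin n) → EuclideanSpace ℝ (Fin n) := fun y => y + f y • e with hF
  have hFL : LipschitzWith (1 + K) F := by
    refine LipschitzWith.id.add ?_
    refine LipschitzWith.of_dist_le_mul fun x y => ?_
    rw [dist_eq_norm, ← sub_smul, norm_smul, he, mul_one, ← dist_eq_norm]
    exact hf.dist_le_mul x y
  set P := ((ℝ ∙ e)ᗮ : Set (EuclideanSpace ℝ (Fin n))) ∩ Metric.closedBall 0 (2 * (‖p‖ + r))
    with hP
  have hsub : frontier Ω.carrier ∩ Metric.ball p r ⊆ F '' P := by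
    rintro x ⟨hx, hxp⟩
    have hg := Ω.graph_eq hf h hx hxp
    refine ⟨x - (inner ℝ e x) • e, ⟨?_, ?_⟩, ?_⟩
    · rw [SetLike.mem_coe, Submodule.mem_orthogonal_singleton_iff_inner_right, inner_sub_right,
        inner_smul_right, real_inner_self_eq_norm_sq, he]
      ring
    · rw [Metric.mem_closedBall, dist_zero_right]
      have h1 : ‖x‖ ≤ ‖p‖ + r := by
        have h2 : ‖x - p‖ < r := by simpa [dist_eq_norm] using hxp
        have h3 := norm_add_le p (x - p)
        rw [add_sub_cancel] at h3
        linarith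
      have h4 : ‖(inner ℝ e x) • e‖ ≤ ‖x‖ := by
        rw [norm_smul, he, mul_one]
        simpa [he] using norm_inner_le_norm (𝕜 := ℝ) e x
      have h5 := norm_sub_le x ((inner ℝ e x) • e)
      linarith
    · simp only [hF]
      rw [← hg]
      abel
  refine lt_of_le_of_lt (measure_mono hsub) ?_
  have hPfin : μHE[n - 1] P < ⊤ := hyperplane_measure_lt_top he _
  rw [Measure.euclideanHausdorffMeasure_def, Measure.smul_apply] at hPfin ⊢
  have hle := hFL.hausdorffMeasure_image_le (d := ((n - 1 : ℕ) : ℝ)) (by positivity) P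
  rw [ENNReal.smul_def, smul_eq_mul] at hPfin ⊢
  refine lt_of_le_of_lt (mul_le_mul_right hle _) ?_
  rw [mul_left_comm]
  exact ENNReal.mul_lt_top (ENNReal.rpow_lt_top_of_nonneg (by positivity) (by simp)) hPfin

/-- `L²_⋄(∂Ω)`: complex `L²`-functions on `∂Ω` with vanishing integral mean. -/
def L2Diamond (Ω : LipschitzDomain n) : Submodule ℂ (Lp ℂ 2 Ω.surf) where
  carrier := {g | ∫ x, g x ∂Ω.surf = 0}
  zero_mem' := by
    rw [Set.mem_ofPred_eq, integral_congr_ae (Lp.coeFn_zero ℂ 2 Ω.surf)]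
    simp
  add_mem' {g h} hg hh := by
    rw [Set.mem_ofPred_eq] at *
    rw [integral_congr_ae (Lp.coeFn_add g h)]
    simp only [Pi.add_apply]
    rw [integral_add ((Lp.memLp g).integrable (by norm_num))
      ((Lp.memLp h).integrable (by norm_num)), hg, hh, add_zero]
  smul_mem' c g hg := by
    rw [Set.mem_ofPred_eq] at *
    rw [integral_congr_ae (Lp.coeFn_smul c g)]
    simp only [Pi.smul_apply]
    rw [integral_smul, hg, smul_zero]

theorem L2Diamond_eq_orthogonal (Ω : LipschitzDomain n) :
    L2Diamond Ω = (ℂ ∙ (Lp.const 2 Ω.surf (1 : ℂ)))ᗮ := by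
  ext g
  rw [Submodule.mem_orthogonal_singleton_iff_inner_right, L2.inner_def]
  have h : ∫ x, inner ℂ ((Lp.const 2 Ω.surf (1 : ℂ)) x) (g x) ∂Ω.surf = ∫ x, g x ∂Ω.surf := by
    refine integral_congr_ae ?_
    filter_upwards [Lp.coeFn_const (p := 2) (μ := Ω.surf) (1 : ℂ)] with x hx
    rw [hx]
    simp
  rw [h]
  rfl

instance (Ω : LipschitzDomain n) : CompleteSpace (L2Diamond Ω) := by
  rw [L2Diamond_eq_orthogonal]
  infer_instance

/-- The classical gradient of a complex-valued function on `ℝⁿ`. -/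
def cgrad (φ : EuclideanSpace ℝ (Fin n) → ℂ) (x : EuclideanSpace ℝ (Fin n)) :
    EuclideanSpace ℂ (Fin n) :=
  WithLp.toLp 2 fun i => fderiv ℝ φ x (EuclideanSpace.single i 1)

/-- The Sobolev space `H¹(Ω)` of complex-valued functions: `u ∈ L²(Ω)` together with its weak
gradient `∇u ∈ L²(Ω)ⁿ` (which is determined by `u`). -/
structure H1 (Ω : LipschitzDomain n) where
  fn : Lp ℂ 2 Ω.vol
  grad : Lp (EuclideanSpace ℂ (Fin n)) 2 Ω.vol
  weak_grad : ∀ φ : EuclideanSpace ℝ (Fin n) → ℝ, ContDiff ℝ ∞ φ → HasCompactSupport φ →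
    tsupport φ ⊆ Ω.carrier → ∀ i : Fin n,
      ∫ x, fn x * ((fderiv ℝ φ x (EuclideanSpace.single i 1) : ℝ) : ℂ) ∂Ω.vol
        = - ∫ x, grad x i * ((φ x : ℝ) : ℂ) ∂Ω.vol

/-- `u|_∂Ω = t` for `u ∈ H¹(Ω)`, `t ∈ L²(∂Ω)`: the trace is the continuous extension of the
restriction to `∂Ω` of functions that are smooth up to the boundary. -/
def H1.HasTrace {Ω : LipschitzDomain n} (u : H1 Ω) (t : Lp ℂ 2 Ω.surf) : Prop :=
  ∃ φ : ℕ → EuclideanSpace ℝ (Fin n) → ℂ, (∀ k, ContDiff ℝ ∞ (φ k)) ∧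
    Tendsto (fun k => eLpNorm (fun x => φ k x - u.fn x) 2 Ω.vol) atTop (𝓝 0) ∧
    Tendsto (fun k => eLpNorm (fun x => cgrad (φ k) x - u.grad x) 2 Ω.vol) atTop (𝓝 0) ∧
    Tendsto (fun k => eLpNorm (fun x => φ k x - t x) 2 Ω.surf) atTop (𝓝 0)

/-- `γ ∈ L^∞_+(Ω;ℝ) + i L^∞(Ω;ℝ)`. -/
def IsAdmittivity (Ω : LipschitzDomain n) (γ : EuclideanSpace ℝ (Fin n) → ℂ) : Prop :=
  MemLp γ ⊤ Ω.vol ∧ ∃ c > 0, ∀ᵐ x ∂Ω.vol, c ≤ (γ x).re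

/-- `u ∈ H¹_⋄(Ω)` is the (weak) solution of `∇ · (γ ∇u) = 0` in `Ω`, `γ ∂_ν u = g` on `∂Ω`:
the trace of `u` has vanishing integral and
`∫_Ω γ ∇u · ∇v dx = ∫_∂Ω g v ds` for all `v ∈ H¹(Ω)`. -/
def IsSolution (Ω : LipschitzDomain n) (γ : EuclideanSpace ℝ (Fin n) → ℂ) (g : L2Diamond Ω)
    (u : H1 Ω) : Prop :=
  (∃ t ∈ L2Diamond Ω, u.HasTrace t) ∧
    ∀ (v : H1 Ω) (s : Lp ℂ 2 Ω.surf), v.HasTrace s →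
      ∫ x, γ x * ∑ i, u.grad x i * v.grad x i ∂Ω.vol
        = ∫ x, (g : Lp ℂ 2 Ω.surf) x * s x ∂Ω.surf

/-- `T` maps each `g ∈ L²_⋄(∂Ω)` to the boundary trace of the solution with Neumann data `g`. -/
def IsNtD (Ω : LipschitzDomain n) (γ : EuclideanSpace ℝ (Fin n) → ℂ)
    (T : L2Diamond Ω →L[ℂ] L2Diamond Ω) : Prop :=
  ∀ g : L2Diamond Ω, ∃ u : H1 Ω, IsSolution Ω γ g u ∧ u.HasTrace (T g : Lp ℂ 2 Ω.surf)

open Classical in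
/-- The Neumann-to-Dirichlet operator `Λ(γ) : L²_⋄(∂Ω) → L²_⋄(∂Ω)`, `g ↦ u_γ^{(g)}|_∂Ω`
(the zero operator for those `γ` for which there is no such bounded operator). -/
def NtD (Ω : LipschitzDomain n) (γ : EuclideanSpace ℝ (Fin n) → ℂ) :
    L2Diamond Ω →L[ℂ] L2Diamond Ω :=
  if h : ∃ T : L2Diamond Ω →L[ℂ] L2Diamond Ω, IsNtD Ω γ T then h.choose else 0

/-- The self-adjoint part `Re(A) = (A + A*)/2` of a bounded operator on `L²_⋄(∂Ω)`. -/
def rePart {Ω : LipschitzDomain n} (A : L2Diamond Ω →L[ℂ] L2Diamond Ω) :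
    L2Diamond Ω →L[ℂ] L2Diamond Ω :=
  (1 / 2 : ℂ) • (A + ContinuousLinearMap.adjoint A)

end

end EIT

namespace EIT

noncomputable section

variable {n : ℕ}

/-! Write a and b for the gradients of the solutions u₁ and u₂ with the same Neumann data g. Testing
the two weak equations with the conjugates of u₁ and u₂ gives ⟪a, γ₁a⟫ = ⟪a, γ₂b⟫ = ⟪Λ(γ₁)g, g⟫ and
⟪b, γ₂b⟫ = ⟪b, γ₁a⟫ = ⟪Λ(γ₂)g, g⟫. The middle term is therefore real and equals Re⟪b, γ₂b⟫ - Re⟪a,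
γ₁a⟫. Adding a vanishing multiple of one of these identities turns it into the integral of γ₂|b|² +
γ₁|a|² - 2γ₂⟪a, b⟫, or of 2γ₁⟪b, a⟫ - γ₂|b|² - γ₁|a|² (real parts). Young's inequality with weight
Re γ₁ (`two_mul_re_mul_inner_le`) cancels |a|² pointwise and leaves the two bounds:
`integral_le_re_sub_re` and `re_sub_re_le_integral`.

Most of the work is to show that `NtD` is the genuine operator and not its default value 0
(`isNtD_NtD`). H¹(Ω) with traces is realized as the closure of the triples (φ, ∇φ, φ|_∂Ω) of smooth
φ, a Hilbert space on which the trace is a coordinate projection, and Lax–Milgram is applied on the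
subspace with zero boundary mean. Coercivity rests on one inequality, `isPoincare_bulk`: up to a
constant, a smooth function is controlled by its gradient in L² of volume plus surface measure,
which is Poincaré and trace inequality at once. It holds on balls by averaging over pairs of points,
near the boundary by sliding along the graph direction into an interior ball, and globally by gluing
along overlaps, using connectedness of Ω and compactness of its closure. -/

/-! ### Elementary inequalities and line integrals. -/

theorem ennreal_add_sq_le (a b : ℝ≥0∞) : (a + b) ^ 2 ≤ 2 * (a ^ 2 + b ^ 2) := by
  induction a with
  | top => simp
  | coe a =>
    induction b with
    | top => simp
    | coe b =>
      have h : (a + b) ^ 2 ≤ 2 * (a ^ 2 + b ^ 2) := by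
        rw [← NNReal.coe_le_coe]
        push_cast
        nlinarith [sq_nonneg ((a : ℝ) - b)]
      exact_mod_cast h

theorem enorm_sub_sq_le {F : Type*} [NormedAddCommGroup F] (a b c : F) :
    ‖a - c‖ₑ ^ 2 ≤ 2 * (‖a - b‖ₑ ^ 2 + ‖b - c‖ₑ ^ 2) := by
  refine le_trans ?_ (ennreal_add_sq_le _ _)
  gcongr
  have h := enorm_add_le (a - b) (b - c)
  rwa [sub_add_sub_cancel] at h

theorem sq_lintegral_le {α : Type*} [MeasurableSpace α] (μ : Measure α) {f : α → ℝ≥0∞}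
    (hf : AEMeasurable f μ) :
    (∫⁻ x, f x ∂μ) ^ 2 ≤ μ Set.univ * ∫⁻ x, f x ^ 2 ∂μ := by
  have h := ENNReal.lintegral_mul_le_Lp_mul_Lq μ (p := 2) (q := 2)
    ⟨by norm_num, by norm_num, by norm_num⟩ hf (aemeasurable_const (b := (1 : ℝ≥0∞)))
  simp only [Pi.mul_apply, mul_one, lintegral_const,
    ENNReal.rpow_two] at h
  refine (pow_le_pow_left' h 2).trans ?_
  rw [mul_pow, ← ENNReal.rpow_mul_natCast, ← ENNReal.rpow_mul_natCast]
  norm_num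
  rw [mul_comm]

theorem fderiv_apply_eq_sum (φ : EuclideanSpace ℝ (Fin n) → ℂ) (x w : EuclideanSpace ℝ (Fin n)) :
    fderiv ℝ φ x w = ∑ i, (w i : ℂ) * cgrad φ x i := by
  have hw : w = ∑ i, w i • EuclideanSpace.single i (1 : ℝ) := by
    ext j
    simp [Finset.sum_apply, Pi.single_apply]
  conv_lhs => rw [hw]
  simp [cgrad, map_sum]

theorem norm_fderiv_apply_le (φ : EuclideanSpace ℝ (Fin n) → ℂ)
    (x w : EuclideanSpace ℝ (Fin n)) :
    ‖fderiv ℝ φ x w‖ ≤ ‖w‖ * ‖cgrad φ x‖ := by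
  have h := norm_inner_le_norm (𝕜 := ℂ)
    (WithLp.toLp 2 fun i => (w i : ℂ) : EuclideanSpace ℂ (Fin n)) (cgrad φ x)
  have hn : ‖(WithLp.toLp 2 fun i => (w i : ℂ) : EuclideanSpace ℂ (Fin n))‖ = ‖w‖ := by
    simp [EuclideanSpace.norm_eq]
  rw [hn] at h
  have hi : inner ℂ (WithLp.toLp 2 fun i => (w i : ℂ) : EuclideanSpace ℂ (Fin n)) (cgrad φ x)
      = fderiv ℝ φ x w := by
    simp [PiLp.inner_apply, fderiv_apply_eq_sum, mul_comm]
  rwa [hi] at h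

theorem continuous_cgrad {φ : EuclideanSpace ℝ (Fin n) → ℂ} (hφ : ContDiff ℝ ∞ φ) :
    Continuous (cgrad φ) := by
  have h : Continuous (fderiv ℝ φ) := hφ.continuous_fderiv (by simp)
  unfold cgrad
  fun_prop

/-- Fundamental theorem of calculus along the segment, then Cauchy–Schwarz on an interval of length
t. -/
theorem enorm_sub_sq_le_lintegral_line {φ : EuclideanSpace ℝ (Fin n) → ℂ} (hφ : ContDiff ℝ ∞ φ)
    (x w : EuclideanSpace ℝ (Fin n)) {t : ℝ} (ht : 0 ≤ t) :
    ‖φ x - φ (x + t • w)‖ₑ ^ 2 ≤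
      ENNReal.ofReal t * (‖w‖ₑ ^ 2 * ∫⁻ τ in Set.Ioc 0 t, ‖cgrad φ (x + τ • w)‖ₑ ^ 2) := by
  have hc : Continuous (fderiv ℝ φ) := hφ.continuous_fderiv (by simp)
  have hcg := continuous_cgrad hφ
  have hd : ∀ τ ∈ Set.uIcc 0 t, HasDerivAt (fun τ : ℝ => φ (x + τ • w))
      (fderiv ℝ φ (x + τ • w) w) τ := fun τ _ => by
    have h1 : HasDerivAt (fun τ : ℝ => x + τ • w) w τ := by
      simpa using ((hasDerivAt_id τ).smul_const w).const_add x
    exact ((hφ.differentiable (by simp)) _).hasFDerivAt.comp_hasDerivAt τ h1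
  have hint := intervalIntegral.integral_eq_sub_of_hasDerivAt hd
    (Continuous.intervalIntegrable (by fun_prop) _ _)
  rw [intervalIntegral.integral_of_le ht, zero_smul, add_zero] at hint
  have h1 : ‖φ x - φ (x + t • w)‖ₑ ≤
      ∫⁻ τ in Set.Ioc 0 t, ‖w‖ₑ * ‖cgrad φ (x + τ • w)‖ₑ := by
    rw [← enorm_neg, neg_sub, ← hint]
    refine (enorm_integral_le_lintegral_enorm _).trans (lintegral_mono fun τ => ?_)
    rw [← ofReal_norm, ← ofReal_norm, ← ofReal_norm, ← ENNReal.ofReal_mul (norm_nonneg _)]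
    exact ENNReal.ofReal_le_ofReal (norm_fderiv_apply_le _ _ _)
  have hm : Measurable fun τ : ℝ => ‖cgrad φ (x + τ • w)‖ₑ :=
    Continuous.measurable (by fun_prop)
  rw [lintegral_const_mul _ hm] at h1
  refine (pow_le_pow_left' h1 2).trans ?_
  rw [mul_pow, mul_left_comm]
  gcongr
  refine (sq_lintegral_le _ hm.aemeasurable).trans ?_
  simp

/-! ### Poincaré inequalities: gluing, balls, transport. -/

/-- A Poincaré inequality on `Ω` with the deviation from constants measured by `μ`. -/
def IsPoincare (Ω : LipschitzDomain n) (μ : Measure (EuclideanSpace ℝ (Fin n))) : Prop :=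
  ∃ C : ℝ≥0, ∀ φ : EuclideanSpace ℝ (Fin n) → ℂ, ContDiff ℝ ∞ φ →
    ∃ c : ℂ, ∫⁻ x, ‖φ x - c‖ₑ ^ 2 ∂μ ≤ C * ∫⁻ x, ‖cgrad φ x‖ₑ ^ 2 ∂Ω.vol

theorem IsPoincare.mono {Ω : LipschitzDomain n} {μ ν : Measure (EuclideanSpace ℝ (Fin n))}
    (h : IsPoincare Ω μ) (hν : ν ≤ μ) : IsPoincare Ω ν := by
  obtain ⟨C, hC⟩ := h
  refine ⟨C, fun φ hφ => ?_⟩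
  obtain ⟨c, hc⟩ := hC φ hφ
  exact ⟨c, (lintegral_mono' hν le_rfl).trans hc⟩

/-- Poincaré inequalities can be glued along a nonzero common part. -/
theorem IsPoincare.add {Ω : LipschitzDomain n} {μ ν l : Measure (EuclideanSpace ℝ (Fin n))}
    [IsFiniteMeasure ν] (hμ : IsPoincare Ω μ) (hν : IsPoincare Ω ν)
    (hlμ : l ≤ μ) (hlν : l ≤ ν) (hl : l ≠ 0) : IsPoincare Ω (μ + ν) := by
  obtain ⟨A, hA⟩ := hμ
  obtain ⟨B, hB⟩ := hν
  have : IsFiniteMeasure l := isFiniteMeasure_of_le ν hlν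
  have hl0 : l Set.univ ≠ 0 := by simpa using hl
  set L : ℝ≥0 := (l Set.univ).toNNReal with hL
  have hLe : (L : ℝ≥0∞) = l Set.univ := ENNReal.coe_toNNReal (measure_ne_top _ _)
  set N : ℝ≥0 := (ν Set.univ).toNNReal with hN
  have hNe : (N : ℝ≥0∞) = ν Set.univ := ENNReal.coe_toNNReal (measure_ne_top _ _)
  have hL0 : L ≠ 0 := fun h => hl0 (by rw [← hLe, h]; rfl)
  refine ⟨A + 2 * (B + (L⁻¹ * (2 * (A + B))) * N), fun φ hφ => ?_⟩
  obtain ⟨a, ha⟩ := hA φ hφ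
  obtain ⟨b, hb⟩ := hB φ hφ
  have hm : ∀ c : ℂ, Measurable fun x => ‖φ x - c‖ₑ ^ 2 := fun c =>
    have := hφ.continuous
    Continuous.measurable (by fun_prop)
  set D := ∫⁻ x, ‖cgrad φ x‖ₑ ^ 2 ∂Ω.vol
  -- On the common part l both constants approximate φ, so integrating over l bounds their distance
  -- by the gradient.
  have hab : ‖b - a‖ₑ ^ 2 ≤ (L⁻¹ * (2 * (A + B)) : ℝ≥0) * D := by
    have h1 : ‖b - a‖ₑ ^ 2 * L ≤ 2 * (A + B) * D := by
      calc ‖b - a‖ₑ ^ 2 * L = ∫⁻ _, ‖b - a‖ₑ ^ 2 ∂l := by rw [lintegral_const, hLe]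
        _ ≤ ∫⁻ x, 2 * (‖φ x - a‖ₑ ^ 2 + ‖φ x - b‖ₑ ^ 2) ∂l := by
            refine lintegral_mono fun x => ?_
            have := enorm_sub_sq_le b (φ x) a
            rwa [← enorm_neg (b - φ x), neg_sub, add_comm] at this
        _ = 2 * (∫⁻ x, ‖φ x - a‖ₑ ^ 2 ∂l + ∫⁻ x, ‖φ x - b‖ₑ ^ 2 ∂l) := by
            rw [lintegral_const_mul' _ _ (by simp), lintegral_add_left (hm a)]
        _ ≤ 2 * (A * D + B * D) := by
            gcongr
            · exact (lintegral_mono' hlμ le_rfl).trans ha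
            · exact (lintegral_mono' hlν le_rfl).trans hb
        _ = 2 * (A + B) * D := by ring
    push_cast
    rw [ENNReal.coe_inv hL0, mul_assoc, ← ENNReal.div_eq_inv_mul]
    rw [ENNReal.le_div_iff_mul_le (Or.inl (by simpa using hL0)) (Or.inl (by simp))]
    exact h1
  -- Recentring ν from b to a costs ‖b - a‖² times the mass of ν, which is finite.
  refine ⟨a, ?_⟩
  rw [lintegral_add_measure]
  calc ∫⁻ x, ‖φ x - a‖ₑ ^ 2 ∂μ + ∫⁻ x, ‖φ x - a‖ₑ ^ 2 ∂ν
      ≤ A * D + ∫⁻ x, 2 * (‖φ x - b‖ₑ ^ 2 + ‖b - a‖ₑ ^ 2) ∂ν := by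
        gcongr
        exact enorm_sub_sq_le _ _ _
    _ = A * D + 2 * (∫⁻ x, ‖φ x - b‖ₑ ^ 2 ∂ν + ‖b - a‖ₑ ^ 2 * N) := by
        rw [lintegral_const_mul' _ _ (by simp), lintegral_add_left (hm b),
          lintegral_const, hNe]
    _ ≤ A * D + 2 * (B * D + (L⁻¹ * (2 * (A + B)) : ℝ≥0) * D * N) := by
        gcongr
    _ = _ := by push_cast; ring

/-- The homothety with centre y and ratio t maps the ball into itself by convexity, and its inverse
Jacobian t⁻ⁿ is at most 2ⁿ. -/
theorem setLIntegral_comp_homothety_le {q y : EuclideanSpace ℝ (Fin n)} {R t : ℝ}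
    (hy : y ∈ Metric.ball q R) (ht : 1 / 2 ≤ t) (ht1 : t ≤ 1)
    {G : EuclideanSpace ℝ (Fin n) → ℝ≥0∞} (hG : Measurable G) :
    ∫⁻ x in Metric.ball q R, G (y + t • (x - y)) ≤ 2 ^ n * ∫⁻ x in Metric.ball q R, G x := by
  have hB : MeasurableSet (Metric.ball q R) := Metric.isOpen_ball.measurableSet
  have hGB : Measurable ((Metric.ball q R).indicator G) := hG.indicator hB
  have ht0 : 0 < t := by linarith
  calc ∫⁻ x in Metric.ball q R, G (y + t • (x - y))
      = ∫⁻ x in Metric.ball q R, (Metric.ball q R).indicator G (t • x + (y - t • y)) := by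
        refine setLIntegral_congr_fun hB fun x hx => ?_
        have hxy : y + t • (x - y) = t • x + (y - t • y) := by
          rw [smul_sub]; abel
        have hmem : t • x + (y - t • y) ∈ Metric.ball q R := by
          rw [← hxy]
          exact (convex_ball q R).add_smul_sub_mem hy hx ⟨ht0.le, ht1⟩
        rw [hxy, Set.indicator_of_mem hmem]
    _ ≤ ∫⁻ x, (Metric.ball q R).indicator G (t • x + (y - t • y)) := setLIntegral_le_lintegral _ _
    _ = ∫⁻ z, (Metric.ball q R).indicator G (z + (y - t • y)) ∂(Measure.map (t • ·) volume) := by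
        rw [lintegral_map (f := fun z => (Metric.ball q R).indicator G (z + (y - t • y)))
          (hGB.comp (measurable_add_const _)) (measurable_const_smul t)]
    _ = ENNReal.ofReal |(t ^ n)⁻¹| * ∫⁻ x in Metric.ball q R, G x := by
        rw [Measure.map_addHaar_smul _ ht0.ne', lintegral_smul_measure,
          lintegral_add_right_eq_self, lintegral_indicator hB, finrank_euclideanSpace_fin,
          smul_eq_mul]
    _ ≤ _ := by
        gcongr
        rw [abs_of_pos (by positivity), ← inv_pow, ENNReal.ofReal_pow (by positivity)]
        gcongr
        rw [← ENNReal.ofReal_ofNat]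
        apply ENNReal.ofReal_le_ofReal
        rw [inv_le_comm₀ ht0 (by norm_num)]
        linarith

/-- The double integral of |φ(x) - φ(y)|² is bounded by integrating the gradient along the segments
from y to x; the constant is then the value of φ at a well-chosen y. -/
theorem isPoincare_ball (Ω : LipschitzDomain n) {q : EuclideanSpace ℝ (Fin n)} {R : ℝ}
    (hR : 0 < R) (hΩ : Metric.ball q R ⊆ Ω.carrier) :
    IsPoincare Ω (volume.restrict (Metric.ball q R)) := by
  set B := Metric.ball q R with hBdef
  have hB : MeasurableSet B := Metric.isOpen_ball.measurableSet
  have hvt : volume B ≠ ⊤ := Metric.isBounded_ball.measure_lt_top.ne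
  have hv0 : volume B ≠ 0 := (Metric.measure_ball_pos volume q hR).ne'
  refine ⟨(2 * R).toNNReal ^ 2 * 2 ^ n, fun φ hφ => ?_⟩
  have hφc := hφ.continuous
  have hcg := continuous_cgrad hφ
  set G : EuclideanSpace ℝ (Fin n) → ℝ≥0∞ := fun x => ‖cgrad φ x‖ₑ ^ 2 with hGdef
  have hGc : Continuous G := by fun_prop
  have hpair : ∫⁻ y in B, ∫⁻ x in B, ‖φ x - φ y‖ₑ ^ 2 ≤
      ENNReal.ofReal (2 * R) ^ 2 * (2 ^ n * (volume B * ∫⁻ x in B, G x)) := by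
    calc ∫⁻ y in B, ∫⁻ x in B, ‖φ x - φ y‖ₑ ^ 2
        ≤ ∫⁻ y in B, ∫⁻ x in B, ENNReal.ofReal (2 * R) ^ 2 *
            ∫⁻ τ in Set.Ioc (0 : ℝ) 1, G (y + τ • (x - y)) := by
          refine setLIntegral_mono' hB fun y hy => setLIntegral_mono' hB fun x hx => ?_
          have h := enorm_sub_sq_le_lintegral_line hφ y (x - y) zero_le_one
          rw [one_smul, add_sub_cancel, ENNReal.ofReal_one, one_mul, ← enorm_neg, neg_sub] at h
          refine h.trans ?_
          gcongr
          rw [← ofReal_norm]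
          apply ENNReal.ofReal_le_ofReal
          rw [← dist_eq_norm]
          have h1 := dist_triangle_right x y q
          rw [hBdef, Metric.mem_ball] at hx hy
          linarith
      _ = ENNReal.ofReal (2 * R) ^ 2 *
            ∫⁻ y in B, ∫⁻ x in B, ∫⁻ τ in Set.Ioc (0 : ℝ) 1, G (y + τ • (x - y)) := by
          rw [← lintegral_const_mul' _ _ (ENNReal.pow_ne_top ENNReal.ofReal_ne_top)]
          congr 1 with y
          rw [← lintegral_const_mul' _ _ (ENNReal.pow_ne_top ENNReal.ofReal_ne_top)]
      _ = ENNReal.ofReal (2 * R) ^ 2 *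
            ∫⁻ τ in Set.Ioc (0 : ℝ) 1, ∫⁻ y in B, ∫⁻ x in B, G (y + τ • (x - y)) := by
          congr 1
          have hsw : ∀ y, ∫⁻ x in B, ∫⁻ τ in Set.Ioc (0 : ℝ) 1, G (y + τ • (x - y)) =
              ∫⁻ τ in Set.Ioc (0 : ℝ) 1, ∫⁻ x in B, G (y + τ • (x - y)) := fun y =>
            lintegral_lintegral_swap
              (Continuous.measurable (by unfold Function.uncurry; fun_prop)).aemeasurable
          simp_rw [hsw]
          rw [lintegral_lintegral_swap]
          · refine Measurable.aemeasurable ?_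
            refine Measurable.lintegral_prod_right'
              (f := fun z : (EuclideanSpace ℝ (Fin n) × ℝ) × EuclideanSpace ℝ (Fin n) =>
                G (z.1.1 + z.1.2 • (z.2 - z.1.1))) ?_
            exact Continuous.measurable (by fun_prop)
      _ ≤ ENNReal.ofReal (2 * R) ^ 2 *
            ∫⁻ τ in Set.Ioc (0 : ℝ) 1, 2 ^ n * (volume B * ∫⁻ x in B, G x) := by
          gcongr ENNReal.ofReal (2 * R) ^ 2 * ?_
          refine setLIntegral_mono' measurableSet_Ioc fun τ hτ => ?_
          have hconst : ∫⁻ _ in B, 2 ^ n * ∫⁻ x in B, G x = 2 ^ n * (volume B * ∫⁻ x in B, G x) := by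
            rw [lintegral_const, Measure.restrict_apply_univ]
            ring
          rw [← hconst]
          -- Contracting towards y alone would cost τ⁻ⁿ, which blows up at 0. For τ ≤ 1/2 the roles
          -- are exchanged: the same point is a contraction of y towards x with ratio 1 - τ ≥ 1/2.
          rcases le_total (1 / 2) τ with h | h
          · exact setLIntegral_mono' hB fun y hy =>
              setLIntegral_comp_homothety_le hy h hτ.2 hGc.measurable
          · rw [lintegral_lintegral_swap
              (Continuous.measurable (by unfold Function.uncurry; fun_prop)).aemeasurable]
            refine setLIntegral_mono' hB fun x hx => ?_
            have h2 := setLIntegral_comp_homothety_le hx (t := 1 - τ) (by linarith)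
              (by linarith [hτ.1]) hGc.measurable
            have he : ∀ y, x + (1 - τ) • (y - x) = y + τ • (x - y) := fun y => by module
            simpa only [he] using h2
      _ = _ := by simp
  -- Some y does no worse than the average.
  obtain ⟨y, hy, hle⟩ := exists_le_setLAverage hv0 hvt
    (f := fun y => ∫⁻ x in B, ‖φ x - φ y‖ₑ ^ 2) (by
      refine Measurable.aemeasurable ?_
      refine Measurable.lintegral_prod_right'
        (f := fun z : EuclideanSpace ℝ (Fin n) × EuclideanSpace ℝ (Fin n) =>
          ‖φ z.2 - φ z.1‖ₑ ^ 2) ?_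
      exact Continuous.measurable (by fun_prop))
  refine ⟨φ y, hle.trans ?_⟩
  rw [setLAverage_eq, ENNReal.div_eq_inv_mul]
  calc (volume B)⁻¹ * ∫⁻ y in B, ∫⁻ x in B, ‖φ x - φ y‖ₑ ^ 2
      ≤ (volume B)⁻¹ *
          (ENNReal.ofReal (2 * R) ^ 2 * (2 ^ n * (volume B * ∫⁻ x in B, G x))) := by gcongr
    _ = ((volume B)⁻¹ * volume B) *
          (ENNReal.ofReal (2 * R) ^ 2 * 2 ^ n * ∫⁻ x in B, G x) := by ring
    _ = ENNReal.ofReal (2 * R) ^ 2 * 2 ^ n * ∫⁻ x in B, G x := by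
        rw [ENNReal.inv_mul_cancel hv0 hvt, one_mul]
    _ ≤ ENNReal.ofReal (2 * R) ^ 2 * 2 ^ n * ∫⁻ x, G x ∂Ω.vol := by
        gcongr
        exact Measure.restrict_mono hΩ le_rfl
    _ = _ := by push_cast; rfl

/-- Compare φ(x) with φ(x + s w), whose deviation from a constant is known in B, and average over s
in (h₁, h]. Hypothesis `hT` says that sweeping ν along w produces at most C times Lebesgue measure,
so both the gradient and the deviation in B become volume integrals. -/
theorem IsPoincare.of_transport {Ω : LipschitzDomain n}
    {ν : Measure (EuclideanSpace ℝ (Fin n))} [SFinite ν] {w : EuclideanSpace ℝ (Fin n)}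
    (hw : ‖w‖ = 1) {B : Set (EuclideanSpace ℝ (Fin n))} (hBm : MeasurableSet B)
    (hB : IsPoincare Ω (volume.restrict B)) {h₁ h : ℝ} (hh₁ : 0 ≤ h₁) (hh : h₁ < h) {C : ℝ≥0}
    (hT : ∀ G : EuclideanSpace ℝ (Fin n) → ℝ≥0∞, Measurable G →
      ∫⁻ x, (∫⁻ s in Set.Ioc 0 h, G (x + s • w)) ∂ν ≤ C * ∫⁻ x, G x)
    (hνΩ : ∀ᵐ x ∂ν, ∀ s ∈ Set.Ioc 0 h, x + s • w ∈ Ω.carrier)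
    (hνB : ∀ᵐ x ∂ν, ∀ s ∈ Set.Ioc h₁ h, x + s • w ∈ B) : IsPoincare Ω ν := by
  obtain ⟨A, hA⟩ := hB
  have hd : (h - h₁).toNNReal ≠ 0 := by simpa using hh
  have hsub : Set.Ioc h₁ h ⊆ Set.Ioc 0 h := Set.Ioc_subset_Ioc_left hh₁
  have hΩm : MeasurableSet Ω.carrier := Ω.isOpen.measurableSet
  refine ⟨(h - h₁).toNNReal⁻¹ * (2 * (h.toNNReal * h.toNNReal * C + C * A)), fun φ hφ => ?_⟩
  obtain ⟨c, hc⟩ := hA φ hφ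
  have hφc := hφ.continuous
  have hcg := continuous_cgrad hφ
  have hGm : Measurable fun x => ‖cgrad φ x‖ₑ ^ 2 := Continuous.measurable (by fun_prop)
  have hFm : Measurable fun x => ‖φ x - c‖ₑ ^ 2 := Continuous.measurable (by fun_prop)
  set D := ∫⁻ x, ‖cgrad φ x‖ₑ ^ 2 ∂Ω.vol with hD
  have h1 : ∫⁻ x, (∫⁻ s in Set.Ioc 0 h, ‖cgrad φ (x + s • w)‖ₑ ^ 2) ∂ν ≤ C * D := by
    rw [hD, ← lintegral_indicator hΩm]
    refine le_trans (lintegral_mono_ae ?_) (hT _ (hGm.indicator hΩm))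
    filter_upwards [hνΩ] with x hx
    refine setLIntegral_mono' measurableSet_Ioc fun s hs => ?_
    rw [Set.indicator_of_mem (hx s hs)]
  have h2 : ∫⁻ x, (∫⁻ s in Set.Ioc h₁ h, ‖φ (x + s • w) - c‖ₑ ^ 2) ∂ν ≤ C * (A * D) := by
    refine le_trans ?_ (mul_le_mul_right hc _)
    rw [← lintegral_indicator hBm]
    refine le_trans (lintegral_mono_ae ?_) (hT _ (hFm.indicator hBm))
    filter_upwards [hνB] with x hx
    refine le_trans (setLIntegral_mono' measurableSet_Ioc fun s hs => ?_)
      (lintegral_mono_set hsub)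
    rw [Set.indicator_of_mem (hx s hs)]
  have hpt : ∀ x, ‖φ x - c‖ₑ ^ 2 * ENNReal.ofReal (h - h₁) ≤
      2 * (ENNReal.ofReal h * ENNReal.ofReal h *
          (∫⁻ s in Set.Ioc 0 h, ‖cgrad φ (x + s • w)‖ₑ ^ 2)
        + ∫⁻ s in Set.Ioc h₁ h, ‖φ (x + s • w) - c‖ₑ ^ 2) := by
    intro x
    set I := ∫⁻ s in Set.Ioc 0 h, ‖cgrad φ (x + s • w)‖ₑ ^ 2 with hI
    have hm : Measurable fun s : ℝ => ‖φ (x + s • w) - c‖ₑ ^ 2 :=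
      Continuous.measurable (by fun_prop)
    calc ‖φ x - c‖ₑ ^ 2 * ENNReal.ofReal (h - h₁)
        = ∫⁻ _ in Set.Ioc h₁ h, ‖φ x - c‖ₑ ^ 2 := by
          rw [lintegral_const, Measure.restrict_apply_univ, Real.volume_Ioc]
      _ ≤ ∫⁻ s in Set.Ioc h₁ h, 2 * (ENNReal.ofReal h * I + ‖φ (x + s • w) - c‖ₑ ^ 2) := by
          refine setLIntegral_mono' measurableSet_Ioc fun s hs => ?_
          refine (enorm_sub_sq_le _ (φ (x + s • w)) _).trans ?_
          gcongr
          have h3 := enorm_sub_sq_le_lintegral_line hφ x w (hsub hs).1.le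
          rw [← ofReal_norm w, hw, ENNReal.ofReal_one, one_pow, one_mul] at h3
          refine h3.trans ?_
          gcongr
          · exact hs.2
          · exact lintegral_mono_set (Set.Ioc_subset_Ioc_right hs.2)
      _ = 2 * (ENNReal.ofReal h * I * ENNReal.ofReal (h - h₁)
            + ∫⁻ s in Set.Ioc h₁ h, ‖φ (x + s • w) - c‖ₑ ^ 2) := by
          rw [lintegral_const_mul' _ _ (by simp), lintegral_add_right _ hm, lintegral_const,
            Measure.restrict_apply_univ, Real.volume_Ioc]
      _ ≤ 2 * (ENNReal.ofReal h * I * ENNReal.ofReal h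
            + ∫⁻ s in Set.Ioc h₁ h, ‖φ (x + s • w) - c‖ₑ ^ 2) := by
          gcongr
          linarith
      _ = _ := by ring
  refine ⟨c, ?_⟩
  push_cast
  rw [ENNReal.coe_inv hd, mul_assoc, ← ENNReal.div_eq_inv_mul,
    ENNReal.le_div_iff_mul_le (Or.inl (by simpa using hh)) (Or.inl (by simp))]
  have hm1 : Measurable fun x => ∫⁻ s in Set.Ioc 0 h, ‖cgrad φ (x + s • w)‖ₑ ^ 2 :=
    Measurable.lintegral_prod_right' (f := fun z : EuclideanSpace ℝ (Fin n) × ℝ =>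
      ‖cgrad φ (z.1 + z.2 • w)‖ₑ ^ 2) (Continuous.measurable (by fun_prop))
  calc (∫⁻ x, ‖φ x - c‖ₑ ^ 2 ∂ν) * ENNReal.ofReal (h - h₁)
      = ∫⁻ x, ‖φ x - c‖ₑ ^ 2 * ENNReal.ofReal (h - h₁) ∂ν :=
        (lintegral_mul_const _ hFm).symm
    _ ≤ _ := lintegral_mono hpt
    _ = 2 * (ENNReal.ofReal h * ENNReal.ofReal h *
          (∫⁻ x, (∫⁻ s in Set.Ioc 0 h, ‖cgrad φ (x + s • w)‖ₑ ^ 2) ∂ν)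
        + ∫⁻ x, (∫⁻ s in Set.Ioc h₁ h, ‖φ (x + s • w) - c‖ₑ ^ 2) ∂ν) := by
        rw [lintegral_const_mul' _ _ (by simp), lintegral_add_left (hm1.const_mul _),
          lintegral_const_mul _ hm1]
    _ ≤ 2 * (ENNReal.ofReal h * ENNReal.ofReal h * (C * D) + C * (A * D)) := by gcongr
    _ = 2 * (ENNReal.ofReal h * ENNReal.ofReal h * C + C * A) * D := by ring

/-! ### Sweeping volume and surface measure along a direction. -/

theorem lintegral_volume_transport_le (S : Set (EuclideanSpace ℝ (Fin n)))
    (w : EuclideanSpace ℝ (Fin n)) (h : ℝ) {G : EuclideanSpace ℝ (Fin n) → ℝ≥0∞}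
    (hG : Measurable G) :
    ∫⁻ x in S, ∫⁻ s in Set.Ioc 0 h, G (x + s • w) ≤ h.toNNReal * ∫⁻ x, G x := by
  have hm : Measurable fun z : EuclideanSpace ℝ (Fin n) × ℝ => G (z.1 + z.2 • w) :=
    hG.comp (Continuous.measurable (by fun_prop))
  rw [lintegral_lintegral_swap hm.aemeasurable]
  calc ∫⁻ s in Set.Ioc 0 h, ∫⁻ x in S, G (x + s • w)
      ≤ ∫⁻ s in Set.Ioc 0 h, ∫⁻ x, G x := by
        refine lintegral_mono fun s => (setLIntegral_le_lintegral _ _).trans ?_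
        rw [lintegral_add_right_eq_self]
    _ = _ := by
        rw [lintegral_const, Measure.restrict_apply_univ, Real.volume_Ioc, sub_zero, mul_comm]
        rfl

theorem inner_eq_zero_of_mem_orthogonal {e : EuclideanSpace ℝ (Fin n)} (y : (ℝ ∙ e)ᗮ) :
    inner ℝ e (y : EuclideanSpace ℝ (Fin n)) = 0 :=
  Submodule.mem_orthogonal_singleton_iff_inner_right.1 y.2

/-- Orthogonal coordinates `(y, s) ↦ y + s e`. -/
theorem exists_orthogonal_coordinates {e : EuclideanSpace ℝ (Fin n)} (he : ‖e‖ = 1) :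
    ∃ L : ((ℝ ∙ e)ᗮ × ℝ) ≃L[ℝ] EuclideanSpace ℝ (Fin n), ∀ y s, L (y, s) = y + s • e := by
  let f : ((ℝ ∙ e)ᗮ × ℝ) →ₗ[ℝ] EuclideanSpace ℝ (Fin n) :=
    (ℝ ∙ e)ᗮ.subtype.coprod (LinearMap.toSpanSingleton ℝ _ e)
  have hf : ∀ y s, f (y, s) = y + s • e := fun y s => by simp [f]
  have hee : inner ℝ e e = (1 : ℝ) := by rw [real_inner_self_eq_norm_sq, he]; norm_num
  have hbij : Function.Bijective f := by
    constructor
    · rw [injective_iff_map_eq_zero]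
      rintro ⟨y, s⟩ h
      rw [hf] at h
      have hs : s = 0 := by
        have h1 := congrArg (inner ℝ e) h
        rw [inner_add_right, inner_smul_right, inner_eq_zero_of_mem_orthogonal, hee,
          inner_zero_right] at h1
        linarith
      subst hs
      rw [zero_smul, add_zero] at h
      ext1
      · exact Subtype.ext h
      · rfl
    · intro x
      refine ⟨(⟨x - (inner ℝ e x : ℝ) • e, ?_⟩, inner ℝ e x), ?_⟩
      · rw [Submodule.mem_orthogonal_singleton_iff_inner_right, inner_sub_right,
          inner_smul_right, hee]
        ring
      · rw [hf]
        simp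
  exact ⟨(LinearEquiv.ofBijective f hbij).toContinuousLinearEquiv, hf⟩

theorem finrank_orthogonal_singleton {e : EuclideanSpace ℝ (Fin n)} (he : ‖e‖ = 1) :
    Module.finrank ℝ (ℝ ∙ e)ᗮ = n - 1 := by
  have h0 : e ≠ 0 := by
    intro h
    simp [h] at he
  have h1 := (ℝ ∙ e).finrank_add_finrank_orthogonal
  rw [finrank_span_singleton h0, finrank_euclideanSpace_fin] at h1
  omega

/-- The graph parametrization over the hyperplane `e^⊥`. -/
def graphMap (e : EuclideanSpace ℝ (Fin n)) (f : EuclideanSpace ℝ (Fin n) → ℝ) :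
    (ℝ ∙ e)ᗮ → EuclideanSpace ℝ (Fin n) := fun y => y + f y • e

theorem lipschitzWith_graphMap {e : EuclideanSpace ℝ (Fin n)} (he : ‖e‖ = 1) {K : ℝ≥0}
    {f : EuclideanSpace ℝ (Fin n) → ℝ} (hf : LipschitzWith K f) :
    LipschitzWith (1 + K) (graphMap e f) := by
  refine LipschitzWith.add (LipschitzWith.subtype_val _) ?_
  refine LipschitzWith.of_dist_le_mul fun x y => ?_
  rw [dist_eq_norm, ← sub_smul, norm_smul, he, mul_one, ← dist_eq_norm]
  exact hf.dist_le_mul x y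

/-- Lipschitz maps enlarge (n-1)-dimensional Hausdorff measure by at most the (n-1)-st power of
their constant; the normalizations on both sides agree since the hyperplane has dimension n - 1. -/
theorem euclideanHausdorff_restrict_graph_le {e : EuclideanSpace ℝ (Fin n)} (he : ‖e‖ = 1)
    {K : ℝ≥0} {f : EuclideanSpace ℝ (Fin n) → ℝ} (hf : LipschitzWith K f)
    {S : Set (EuclideanSpace ℝ (Fin n))} (hS : S ⊆ Set.range (graphMap e f)) :
    (μHE[n - 1]).restrict S ≤
      (((1 + K) ^ (n - 1) : ℝ≥0) : ℝ≥0∞) • Measure.map (graphMap e f) volume := by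
  have hL := lipschitzWith_graphMap he hf
  refine Measure.le_iff.2 fun A hA => ?_
  rw [Measure.restrict_apply hA, Measure.smul_apply, Measure.map_apply hL.continuous.measurable hA,
    smul_eq_mul]
  have hsub : A ∩ S ⊆ graphMap e f '' (graphMap e f ⁻¹' A) := by
    rintro x ⟨hxA, hxS⟩
    obtain ⟨y, rfl⟩ := hS hxS
    exact ⟨y, hxA, rfl⟩
  refine (measure_mono hsub).trans ?_
  rw [← InnerProductSpace.euclideanHausdorffMeasure_eq_volume, finrank_orthogonal_singleton he,
    Measure.euclideanHausdorffMeasure_def, Measure.euclideanHausdorffMeasure_def,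
    Measure.smul_apply, Measure.smul_apply, ENNReal.smul_def, ENNReal.smul_def, smul_eq_mul,
    smul_eq_mul, mul_left_comm]
  gcongr
  have hle := hL.hausdorffMeasure_image_le (d := ((n - 1 : ℕ) : ℝ)) (by positivity)
    (graphMap e f ⁻¹' A)
  rw [ENNReal.rpow_natCast] at hle
  exact_mod_cast hle

/-- In coordinates (y, s) ↦ y + s e, sliding the graph along -e is a shear composed with a
reflection, so the swept measure is at most a multiple of Lebesgue measure, uniformly in S and h. -/
theorem exists_lintegral_graph_transport_le {e : EuclideanSpace ℝ (Fin n)} (he : ‖e‖ = 1)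
    {K : ℝ≥0} {f : EuclideanSpace ℝ (Fin n) → ℝ} (hf : LipschitzWith K f) :
    ∃ C : ℝ≥0, ∀ S ⊆ Set.range (graphMap e f), ∀ (h : ℝ)
      (G : EuclideanSpace ℝ (Fin n) → ℝ≥0∞), Measurable G →
      ∫⁻ x, (∫⁻ s in Set.Ioc 0 h, G (x + s • -e)) ∂(μHE[n - 1]).restrict S ≤
        C * ∫⁻ x, G x := by
  obtain ⟨L, hL⟩ := exists_orthogonal_coordinates he
  set m : Measure (EuclideanSpace ℝ (Fin n)) :=
    Measure.map L ((volume : Measure (ℝ ∙ e)ᗮ).prod (volume : Measure ℝ)) with hm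
  have hHaar : m.IsAddHaarMeasure := L.isAddHaarMeasure_map _
  set c : ℝ≥0 := Measure.addHaarScalarFactor m volume
  have hmc : m = c • volume := Measure.isAddLeftInvariant_eq_smul m volume
  refine ⟨(1 + K) ^ (n - 1) * c, fun S hS h G hG => ?_⟩
  have hg := (lipschitzWith_graphMap he hf).continuous.measurable
  have hGm : Measurable fun x => ∫⁻ s in Set.Ioc 0 h, G (x + s • -e) :=
    Measurable.lintegral_prod_right' (f := fun z : EuclideanSpace ℝ (Fin n) × ℝ =>
      G (z.1 + z.2 • -e)) (hG.comp (Continuous.measurable (by fun_prop)))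
  have hGL : Measurable fun z : (ℝ ∙ e)ᗮ × ℝ => G (L z) := hG.comp L.continuous.measurable
  calc ∫⁻ x, (∫⁻ s in Set.Ioc 0 h, G (x + s • -e)) ∂(μHE[n - 1]).restrict S
      ≤ ∫⁻ x, (∫⁻ s in Set.Ioc 0 h, G (x + s • -e))
          ∂((((1 + K) ^ (n - 1) : ℝ≥0) : ℝ≥0∞) • Measure.map (graphMap e f) volume) :=
        lintegral_mono' (euclideanHausdorff_restrict_graph_le he hf hS) le_rfl
    _ = (((1 + K) ^ (n - 1) : ℝ≥0) : ℝ≥0∞) *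
          ∫⁻ y, ∫⁻ s in Set.Ioc 0 h, G (graphMap e f y + s • -e) := by
        rw [lintegral_smul_measure, lintegral_map hGm hg, smul_eq_mul]
    _ ≤ (((1 + K) ^ (n - 1) : ℝ≥0) : ℝ≥0∞) * ∫⁻ y : (ℝ ∙ e)ᗮ, ∫⁻ s : ℝ, G (L (y, s)) := by
        refine mul_le_mul_right (lintegral_mono fun y => ?_) _
        refine (setLIntegral_le_lintegral _ _).trans_eq ?_
        -- Substituting f y - s for s straightens the graph.
        rw [← lintegral_sub_left_eq_self _ (f y)]
        congr 1 with s
        rw [hL, graphMap]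
        congr 1
        module
    _ = (((1 + K) ^ (n - 1) : ℝ≥0) : ℝ≥0∞) * ∫⁻ x, G x ∂m := by
        rw [hm, lintegral_map hG L.continuous.measurable, lintegral_prod _ hGL.aemeasurable]
    _ = _ := by
        rw [hmc, lintegral_smul_measure, ENNReal.smul_def, smul_eq_mul]
        push_cast
        ring

/-! ### Local Poincaré inequalities and their globalization. -/

/-- Volume plus surface measure of a domain. -/
def LipschitzDomain.bulk (Ω : LipschitzDomain n) : Measure (EuclideanSpace ℝ (Fin n)) :=
  Ω.vol + Ω.surf

instance (Ω : LipschitzDomain n) : IsFiniteMeasure Ω.vol :=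
  ⟨by rw [Measure.restrict_apply_univ]; exact Ω.isBounded.measure_lt_top⟩

instance (Ω : LipschitzDomain n) : IsFiniteMeasure Ω.bulk := by
  unfold LipschitzDomain.bulk
  infer_instance

theorem bulk_restrict_ball {Ω : LipschitzDomain n} {p : EuclideanSpace ℝ (Fin n)} {R : ℝ}
    (hsub : Metric.ball p R ⊆ Ω.carrier) :
    Ω.bulk.restrict (Metric.ball p R) = volume.restrict (Metric.ball p R) := by
  have hempty : Metric.ball p R ∩ frontier Ω.carrier = ∅ := by
    rw [Ω.isOpen.frontier_eq, Set.eq_empty_iff_forall_notMem]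
    exact fun x hx => hx.2.2 (hsub hx.1)
  rw [LipschitzDomain.bulk, Measure.restrict_add, Measure.restrict_restrict
    Metric.isOpen_ball.measurableSet, Measure.restrict_restrict Metric.isOpen_ball.measurableSet,
    Set.inter_eq_left.2 hsub, hempty]
  simp

theorem exists_isPoincare_restrict_of_mem {Ω : LipschitzDomain n} {p : EuclideanSpace ℝ (Fin n)}
    (hp : p ∈ Ω.carrier) :
    ∃ W, IsOpen W ∧ p ∈ W ∧ IsPoincare Ω (Ω.bulk.restrict W) := by
  obtain ⟨R, hR, hsub⟩ := Metric.isOpen_iff.1 Ω.isOpen p hp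
  refine ⟨Metric.ball p R, Metric.isOpen_ball, Metric.mem_ball_self hR, ?_⟩
  rw [bulk_restrict_ball hsub]
  exact isPoincare_ball Ω hR hsub

/-- Moving down from the graph enters Ω and, after length about r/2, reaches a ball inside Ω;
`IsPoincare.of_transport` brings the inequality back, for volume and surface parts together. -/
theorem exists_isPoincare_restrict_of_mem_frontier {Ω : LipschitzDomain n}
    {p : EuclideanSpace ℝ (Fin n)} (hp : p ∈ frontier Ω.carrier) :
    ∃ W, IsOpen W ∧ p ∈ W ∧ IsPoincare Ω (Ω.bulk.restrict W) := by
  obtain ⟨e, he, K, f, hf, r, hr, hgraph⟩ := Ω.locally_graph p hp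
  have hee : inner ℝ e e = (1 : ℝ) := by rw [real_inner_self_eq_norm_sq, he]; norm_num
  have hcl : ∀ x ∈ closure Ω.carrier, x ∈ Metric.ball p r →
      inner ℝ e x ≤ f (x - (inner ℝ e x) • e) := by
    intro x hx hxp
    by_cases hxΩ : x ∈ Ω.carrier
    · exact ((hgraph x hxp).1 hxΩ).le
    · refine (Ω.graph_eq hf hgraph ?_ hxp).le
      rw [Ω.isOpen.frontier_eq]
      exact ⟨hx, hxΩ⟩
  have hdown : ∀ x ∈ closure Ω.carrier, x ∈ Metric.ball p (r / 4) → ∀ s ∈ Set.Ioc 0 (r / 2),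
      x + s • -e ∈ Ω.carrier := by
    intro x hx hxp s hs
    rw [Metric.mem_ball] at hxp
    have hmem : x + s • -e ∈ Metric.ball p r := by
      rw [Metric.mem_ball]
      have h1 : dist (x + s • -e) x = s := by
        rw [dist_eq_norm, add_sub_cancel_left, norm_smul, norm_neg, he, mul_one,
          Real.norm_of_nonneg hs.1.le]
      linarith [dist_triangle (x + s • -e) x p, hs.2]
    refine (hgraph _ hmem).2 ?_
    have hi : inner ℝ e (x + s • -e) = inner ℝ e x - s := by
      rw [inner_add_right, inner_smul_right, inner_neg_right, hee]
      ring
    have hproj : x + s • -e - (inner ℝ e (x + s • -e) : ℝ) • e = x - (inner ℝ e x : ℝ) • e := by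
      rw [hi]
      module
    rw [hproj, hi]
    have := hcl x hx (Metric.ball_subset_ball (by linarith) (Metric.mem_ball.2 hxp))
    linarith [hs.1]
  set q := p + (r / 2) • -e with hq
  have hqΩ : q ∈ Ω.carrier := hdown p (frontier_subset_closure hp)
    (Metric.mem_ball_self (by positivity)) _ ⟨by positivity, le_rfl⟩
  obtain ⟨R, hR, hsub⟩ := Metric.isOpen_iff.1 Ω.isOpen q hqΩ
  -- The bound r/4 keeps paths of length r/2 inside the graph chart; R/2 makes the endpoints for s >
  -- r/2 - ρ lie within 2ρ ≤ R of q.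
  set ρ := min (r / 4) (R / 2) with hρ
  have hρ0 : 0 < ρ := by positivity
  have hWm : MeasurableSet (Metric.ball p ρ) := Metric.isOpen_ball.measurableSet
  have hWr : Metric.ball p ρ ⊆ Metric.ball p (r / 4) :=
    Metric.ball_subset_ball (min_le_left _ _)
  refine ⟨Metric.ball p ρ, Metric.isOpen_ball, Metric.mem_ball_self hρ0, ?_⟩
  have hμ : Ω.bulk.restrict (Metric.ball p ρ) =
      volume.restrict (Metric.ball p ρ ∩ Ω.carrier) +
        (μHE[n - 1]).restrict (Metric.ball p ρ ∩ frontier Ω.carrier) := by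
    rw [LipschitzDomain.bulk, Measure.restrict_add, Measure.restrict_restrict hWm,
      Measure.restrict_restrict hWm]
  have hae : ∀ᵐ x ∂Ω.bulk.restrict (Metric.ball p ρ),
      x ∈ closure Ω.carrier ∧ x ∈ Metric.ball p ρ := by
    rw [hμ, ae_add_measure_iff]
    constructor
    · filter_upwards [ae_restrict_mem (hWm.inter Ω.isOpen.measurableSet)] with x hx
      exact ⟨subset_closure hx.2, hx.1⟩
    · filter_upwards [ae_restrict_mem (hWm.inter isClosed_frontier.measurableSet)] with x hx
      exact ⟨frontier_subset_closure hx.2, hx.1⟩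
  obtain ⟨C, hC⟩ := exists_lintegral_graph_transport_le he hf
  refine IsPoincare.of_transport (w := -e) (by rwa [norm_neg])
    (Metric.isOpen_ball (x := q) (ε := R)).measurableSet (isPoincare_ball Ω hR hsub)
    (h₁ := r / 2 - ρ) (h := r / 2) (by linarith [min_le_left (r / 4) (R / 2)]) (by linarith)
    (C := (r / 2).toNNReal + C) ?_ ?_ ?_
  · intro G hG
    rw [hμ, lintegral_add_measure]
    push_cast
    rw [add_mul]
    refine add_le_add (lintegral_volume_transport_le _ _ _ hG) (hC _ ?_ _ _ hG)
    rintro x ⟨hxp, hx⟩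
    refine ⟨⟨x - (inner ℝ e x : ℝ) • e, ?_⟩, ?_⟩
    · rw [Submodule.mem_orthogonal_singleton_iff_inner_right, inner_sub_right,
        inner_smul_right, hee]
      ring
    · rw [graphMap]
      simp only
      rw [← Ω.graph_eq hf hgraph hx (Metric.ball_subset_ball (by linarith) (hWr hxp))]
      abel
  · filter_upwards [hae] with x hx
    exact hdown x hx.1 (hWr hx.2)
  · filter_upwards [hae] with x hx s hs
    have hxp := hx.2
    rw [Metric.mem_ball, dist_eq_norm] at hxp ⊢
    have hdec : x + s • -e - q = (x - p) + (r / 2 - s) • e := by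
      rw [hq]
      module
    have hn : ‖(r / 2 - s) • e‖ = r / 2 - s := by
      rw [norm_smul, he, mul_one, Real.norm_of_nonneg (by linarith [hs.2])]
    rw [hdec]
    have := norm_add_le (x - p) ((r / 2 - s) • e)
    linarith [hs.1, min_le_right (r / 4) (R / 2)]

theorem exists_isPoincare_restrict {Ω : LipschitzDomain n} {p : EuclideanSpace ℝ (Fin n)}
    (hp : p ∈ closure Ω.carrier) :
    ∃ W, IsOpen W ∧ p ∈ W ∧ IsPoincare Ω (Ω.bulk.restrict W) := by
  by_cases hpΩ : p ∈ Ω.carrier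
  · exact exists_isPoincare_restrict_of_mem hpΩ
  · refine exists_isPoincare_restrict_of_mem_frontier ?_
    rw [Ω.isOpen.frontier_eq]
    exact ⟨hp, hpΩ⟩

/-- The Poincaré and trace inequality on a bounded Lipschitz domain. -/
theorem isPoincare_bulk (Ω : LipschitzDomain n) : IsPoincare Ω Ω.bulk := by
  obtain ⟨q, hq⟩ := Ω.isConnected.nonempty
  obtain ⟨R, hR, hsub⟩ := Metric.isOpen_iff.1 Ω.isOpen q hq
  set β : Measure (EuclideanSpace ℝ (Fin n)) := volume.restrict (Metric.ball q R) with hβ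
  have hβP : IsPoincare Ω β := isPoincare_ball Ω hR hsub
  have hβf : IsFiniteMeasure β :=
    ⟨by rw [Measure.restrict_apply_univ]; exact measure_ball_lt_top⟩
  have hβ0 : β ≠ 0 := by
    rw [hβ, Ne, Measure.restrict_eq_zero]
    exact (Metric.measure_ball_pos volume q hR).ne'
  have hle : ∀ {U W : Set (EuclideanSpace ℝ (Fin n))}, IsOpen W → U ⊆ W ∩ Ω.carrier →
      volume.restrict U ≤ Ω.bulk.restrict W := by
    intro U W hW hU
    rw [LipschitzDomain.bulk, Measure.restrict_add, Measure.restrict_restrict hW.measurableSet]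
    exact (Measure.restrict_mono hU le_rfl).trans (Measure.le_add_right le_rfl)
  -- Carrying the fixed ball measure β along ensures that any two good pieces have a nonzero common
  -- part, so they can be glued even if they are disjoint.
  set good : EuclideanSpace ℝ (Fin n) → Prop := fun p =>
    ∃ W, IsOpen W ∧ p ∈ W ∧ IsPoincare Ω (Ω.bulk.restrict W + β) with hgood
  have hnext : ∀ {x p : EuclideanSpace ℝ (Fin n)} {V : Set (EuclideanSpace ℝ (Fin n))},
      IsOpen V → p ∈ V → IsPoincare Ω (Ω.bulk.restrict V) → x ∈ V → x ∈ Ω.carrier → good x →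
      good p := by
    rintro x p V hV hp hVP hxV hx ⟨W, hW, hxW, hP⟩
    refine ⟨V, hV, hp, ?_⟩
    -- A nonempty open part of Ω common to both neighbourhoods has positive volume and serves as
    -- overlap.
    have hU : IsOpen (W ∩ (V ∩ Ω.carrier)) := hW.inter (hV.inter Ω.isOpen)
    have hglue := hP.add hVP (l := volume.restrict (W ∩ (V ∩ Ω.carrier)))
      ((hle hW (fun y hy => ⟨hy.1, hy.2.2⟩)).trans (Measure.le_add_right le_rfl))
      (hle hV fun y hy => hy.2) (by
        rw [Ne, Measure.restrict_eq_zero]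
        exact (hU.measure_pos volume ⟨x, hxW, hxV, hx⟩).ne')
    refine hglue.mono ?_
    rw [add_comm]
    exact add_le_add (Measure.le_add_left le_rfl) le_rfl
  have hgoodopen : IsOpen {p | good p} := by
    rw [isOpen_iff_forall_mem_open]
    rintro p ⟨W, hW, hp, hP⟩
    exact ⟨W, fun x hx => ⟨W, hW, hx, hP⟩, hW, hp⟩
  have hΩgood : Ω.carrier ⊆ {p | good p} ∩ Ω.carrier := by
    -- The good points of Ω form a nonempty, open and relatively closed subset.
    refine Ω.isConnected.isPreconnected.subset_of_closure_inter_subset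
      (hgoodopen.inter Ω.isOpen) ⟨q, hq, ?_, hq⟩ ?_
    · refine ⟨Metric.ball q R, Metric.isOpen_ball, Metric.mem_ball_self hR, ?_⟩
      rw [bulk_restrict_ball hsub]
      exact hβP.add hβP le_rfl le_rfl hβ0
    · rintro p ⟨hp, hpΩ⟩
      refine ⟨?_, hpΩ⟩
      obtain ⟨V, hV, hpV, hVP⟩ := exists_isPoincare_restrict_of_mem hpΩ
      obtain ⟨x, hxV, hxg, hxΩ⟩ := mem_closure_iff.1 hp V hV hpV
      exact hnext hV hpV hVP hxV hxΩ hxg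
  have hclgood : ∀ p ∈ closure Ω.carrier, good p := by
    intro p hp
    obtain ⟨V, hV, hpV, hVP⟩ := exists_isPoincare_restrict hp
    obtain ⟨x, hxV, hxΩ⟩ := mem_closure_iff.1 hp V hV hpV
    exact hnext hV hpV hVP hxV hxΩ (hΩgood hxΩ).1
  have hcomp : IsCompact (closure Ω.carrier) := Ω.isBounded.isCompact_closure
  have hfin : IsPoincare Ω (Ω.bulk.restrict (closure Ω.carrier) + β) := by
    refine hcomp.induction_on (p := fun s => IsPoincare Ω (Ω.bulk.restrict s + β)) ?_ ?_ ?_ ?_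
    · simpa using hβP
    · intro s t hst ht
      exact ht.mono (add_le_add (Measure.restrict_mono hst le_rfl) le_rfl)
    · intro s t hs ht
      refine (hs.add ht (l := β) (Measure.le_add_left le_rfl) (Measure.le_add_left le_rfl)
        hβ0).mono ?_
      calc Ω.bulk.restrict (s ∪ t) + β ≤ (Ω.bulk.restrict s + Ω.bulk.restrict t) + β :=
            add_le_add (Measure.restrict_union_le _ _) le_rfl
        _ = Ω.bulk.restrict s + (Ω.bulk.restrict t + β) := add_assoc _ _ _
        _ ≤ (Ω.bulk.restrict s + β) + (Ω.bulk.restrict t + β) :=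
            add_le_add (Measure.le_add_right le_rfl) le_rfl
    · intro x hx
      obtain ⟨W, hW, hxW, hP⟩ := hclgood x hx
      exact ⟨W, mem_nhdsWithin_of_mem_nhds (hW.mem_nhds hxW), hP⟩
  refine hfin.mono ?_
  have hc : MeasurableSet (closure Ω.carrier) := isClosed_closure.measurableSet
  have heq : Ω.bulk.restrict (closure Ω.carrier) = Ω.bulk := by
    rw [LipschitzDomain.bulk, Measure.restrict_add, Measure.restrict_restrict hc,
      Measure.restrict_restrict hc, Set.inter_eq_right.2 subset_closure,
      Set.inter_eq_right.2 frontier_subset_closure]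
  rw [heq]
  exact Measure.le_add_right le_rfl

/-! ### H¹(Ω) with traces as a closed space of triples. -/

theorem Continuous.memLp_of_ae_mem_closure {Ω : LipschitzDomain n} {F : Type*}
    [NormedAddCommGroup F] [SecondCountableTopology F] {f : EuclideanSpace ℝ (Fin n) → F}
    (hf : Continuous f) {ν : Measure (EuclideanSpace ℝ (Fin n))} [IsFiniteMeasure ν]
    (hν : ∀ᵐ x ∂ν, x ∈ closure Ω.carrier) (p : ℝ≥0∞) : MemLp f p ν := by
  obtain ⟨C, hC⟩ := Ω.isBounded.isCompact_closure.exists_bound_of_continuousOn hf.continuousOn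
  refine MemLp.of_bound hf.aestronglyMeasurable C ?_
  filter_upwards [hν] with x hx using hC x hx

theorem Continuous.memLp_vol (Ω : LipschitzDomain n) {F : Type*}
    [NormedAddCommGroup F] [SecondCountableTopology F] {f : EuclideanSpace ℝ (Fin n) → F}
    (hf : Continuous f) : MemLp f 2 Ω.vol := by
  refine Continuous.memLp_of_ae_mem_closure (Ω := Ω) hf ?_ 2
  filter_upwards [ae_restrict_mem Ω.isOpen.measurableSet] with x hx using subset_closure hx

theorem Continuous.memLp_surf (Ω : LipschitzDomain n) {F : Type*}
    [NormedAddCommGroup F] [SecondCountableTopology F] {f : EuclideanSpace ℝ (Fin n) → F}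
    (hf : Continuous f) : MemLp f 2 Ω.surf := by
  refine Continuous.memLp_of_ae_mem_closure (Ω := Ω) hf ?_ 2
  filter_upwards [ae_restrict_mem isClosed_frontier.measurableSet] with x hx using
    frontier_subset_closure hx

/-- Triples (function, gradient, boundary values). -/
abbrev TraceSpace (Ω : LipschitzDomain n) : Type :=
  WithLp 2 (Lp ℂ 2 Ω.vol × WithLp 2 (Lp (EuclideanSpace ℂ (Fin n)) 2 Ω.vol × Lp ℂ 2 Ω.surf))

variable {Ω : LipschitzDomain n}

/-- The triple with the given components. -/
def traceData (f : Lp ℂ 2 Ω.vol) (G : Lp (EuclideanSpace ℂ (Fin n)) 2 Ω.vol)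
    (t : Lp ℂ 2 Ω.surf) : TraceSpace Ω :=
  WithLp.toLp 2 (f, WithLp.toLp 2 (G, t))

/-- The function component. -/
def valL (Ω : LipschitzDomain n) : TraceSpace Ω →L[ℂ] Lp ℂ 2 Ω.vol := WithLp.fstL 2 ℂ _ _

/-- The gradient component. -/
def gradL (Ω : LipschitzDomain n) :
    TraceSpace Ω →L[ℂ] Lp (EuclideanSpace ℂ (Fin n)) 2 Ω.vol :=
  WithLp.fstL 2 ℂ _ _ ∘L WithLp.sndL 2 ℂ _ _

/-- The boundary component. -/
def trL (Ω : LipschitzDomain n) : TraceSpace Ω →L[ℂ] Lp ℂ 2 Ω.surf :=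
  WithLp.sndL 2 ℂ _ _ ∘L WithLp.sndL 2 ℂ _ _

@[simp] theorem valL_traceData (f : Lp ℂ 2 Ω.vol) (G : Lp (EuclideanSpace ℂ (Fin n)) 2 Ω.vol)
    (t : Lp ℂ 2 Ω.surf) : valL Ω (traceData f G t) = f := rfl

@[simp] theorem gradL_traceData (f : Lp ℂ 2 Ω.vol) (G : Lp (EuclideanSpace ℂ (Fin n)) 2 Ω.vol)
    (t : Lp ℂ 2 Ω.surf) : gradL Ω (traceData f G t) = G := rfl

@[simp] theorem trL_traceData (f : Lp ℂ 2 Ω.vol) (G : Lp (EuclideanSpace ℂ (Fin n)) 2 Ω.vol)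
    (t : Lp ℂ 2 Ω.surf) : trL Ω (traceData f G t) = t := rfl

theorem TraceSpace.norm_le (z : TraceSpace Ω) :
    ‖z‖ ≤ ‖valL Ω z‖ + ‖gradL Ω z‖ + ‖trL Ω z‖ := by
  have h : ‖z‖ ^ 2 = ‖valL Ω z‖ ^ 2 + (‖gradL Ω z‖ ^ 2 + ‖trL Ω z‖ ^ 2) := by
    rw [WithLp.prod_norm_sq_eq_of_L2, WithLp.prod_norm_sq_eq_of_L2]
    rfl
  have h1 := norm_nonneg (valL Ω z)
  have h2 := norm_nonneg (gradL Ω z)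
  have h3 := norm_nonneg (trL Ω z)
  refine (pow_le_pow_iff_left₀ (norm_nonneg _) (by positivity) two_ne_zero).1 ?_
  nlinarith [mul_nonneg h1 h2, mul_nonneg h1 h3, mul_nonneg h2 h3]

theorem continuous_traceData : Continuous
    fun z : Lp ℂ 2 Ω.vol × Lp (EuclideanSpace ℂ (Fin n)) 2 Ω.vol × Lp ℂ 2 Ω.surf =>
      traceData z.1 z.2.1 z.2.2 := by
  unfold traceData
  fun_prop

/-- The triple of a smooth function. -/
def smoothData (Ω : LipschitzDomain n) (φ : EuclideanSpace ℝ (Fin n) → ℂ) (hφ : ContDiff ℝ ∞ φ) :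
    TraceSpace Ω :=
  traceData ((Continuous.memLp_vol Ω hφ.continuous).toLp φ)
    ((Continuous.memLp_vol Ω (continuous_cgrad hφ)).toLp (cgrad φ))
    ((Continuous.memLp_surf Ω hφ.continuous).toLp φ)

theorem cgrad_add {φ ψ : EuclideanSpace ℝ (Fin n) → ℂ} (hφ : ContDiff ℝ ∞ φ)
    (hψ : ContDiff ℝ ∞ ψ) : cgrad (φ + ψ) = cgrad φ + cgrad ψ := by
  ext x i
  have h := fderiv_add (hφ.differentiable (by simp) x) (hψ.differentiable (by simp) x)
  simp [cgrad, h]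

theorem cgrad_const_smul {φ : EuclideanSpace ℝ (Fin n) → ℂ} (hφ : ContDiff ℝ ∞ φ) (c : ℂ) :
    cgrad (c • φ) = c • cgrad φ := by
  ext x i
  have h := fderiv_const_smul (hφ.differentiable (by simp) x) c
  simp [cgrad, h]

theorem cgrad_const (c : ℂ) : cgrad (fun _ : EuclideanSpace ℝ (Fin n) => c) = 0 := by
  ext x i
  simp [cgrad]

/-- The triples of smooth functions. -/
def smoothSubmodule (Ω : LipschitzDomain n) : Submodule ℂ (TraceSpace Ω) where
  carrier := {z | ∃ φ hφ, smoothData Ω φ hφ = z}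
  zero_mem' := by
    refine ⟨fun _ => 0, contDiff_const, ?_⟩
    simp only [smoothData, cgrad_const]
    rfl
  add_mem' := by
    rintro _ _ ⟨φ, hφ, rfl⟩ ⟨ψ, hψ, rfl⟩
    refine ⟨φ + ψ, hφ.add hψ, ?_⟩
    simp only [smoothData, cgrad_add hφ hψ]
    rfl
  smul_mem' := by
    rintro c _ ⟨φ, hφ, rfl⟩
    refine ⟨c • φ, hφ.const_smul c, ?_⟩
    simp only [smoothData, cgrad_const_smul hφ]
    rfl

/-- `H¹(Ω)`, as the closed space of triples `(u, ∇u, u|_∂Ω)`. -/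
def sobolev (Ω : LipschitzDomain n) : Submodule ℂ (TraceSpace Ω) :=
  (smoothSubmodule Ω).topologicalClosure

theorem isClosed_sobolev (Ω : LipschitzDomain n) : IsClosed (sobolev Ω : Set (TraceSpace Ω)) :=
  Submodule.isClosed_topologicalClosure _

theorem smoothData_mem_sobolev (φ : EuclideanSpace ℝ (Fin n) → ℂ) (hφ : ContDiff ℝ ∞ φ) :
    smoothData Ω φ hφ ∈ sobolev Ω :=
  Submodule.le_topologicalClosure _ ⟨φ, hφ, rfl⟩

theorem tendsto_toLp_iff {α F ι : Type*} [MeasurableSpace α] {μ : Measure α}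
    [NormedAddCommGroup F] {l : Filter ι} {f : ι → α → F} (hf : ∀ k, MemLp (f k) 2 μ)
    (g : Lp F 2 μ) :
    Tendsto (fun k => (hf k).toLp (f k)) l (𝓝 g) ↔
      Tendsto (fun k => eLpNorm (fun x => f k x - g x) 2 μ) l (𝓝 0) := by
  have h := Lp.tendsto_Lp_iff_tendsto_eLpNorm'' (fi := l) f hf g (Lp.memLp g)
  rw [Lp.toLp_coeFn] at h
  exact h

/-- The three limits in the definition of a trace are exactly convergence of smooth triples in the
product norm; the next lemma is the converse. -/
theorem H1.HasTrace.mem_sobolev {u : H1 Ω} {t : Lp ℂ 2 Ω.surf} (h : u.HasTrace t) :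
    traceData u.fn u.grad t ∈ sobolev Ω := by
  obtain ⟨φ, hφ, h1, h2, h3⟩ := h
  have h1' := (tendsto_toLp_iff (fun k => Continuous.memLp_vol Ω (hφ k).continuous) u.fn).2 h1
  have h2' := (tendsto_toLp_iff
    (fun k => Continuous.memLp_vol Ω (continuous_cgrad (hφ k))) u.grad).2 h2
  have h3' := (tendsto_toLp_iff (fun k => Continuous.memLp_surf Ω (hφ k).continuous) t).2 h3
  have hlim := (continuous_traceData (Ω := Ω)).continuousAt.tendsto.comp
    (h1'.prodMk_nhds (h2'.prodMk_nhds h3'))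
  exact (isClosed_sobolev Ω).mem_of_tendsto hlim
    (Eventually.of_forall fun k => smoothData_mem_sobolev (φ k) (hφ k))

theorem H1.hasTrace_of_mem_sobolev {u : H1 Ω} {t : Lp ℂ 2 Ω.surf}
    (h : traceData u.fn u.grad t ∈ sobolev Ω) : u.HasTrace t := by
  obtain ⟨z, hz, hlim⟩ := mem_closure_iff_seq_limit.1 h
  choose φ hφ hzφ using hz
  have hlim1 := ((valL Ω).continuous.tendsto _).comp hlim
  have hlim2 := ((gradL Ω).continuous.tendsto _).comp hlim
  have hlim3 := ((trL Ω).continuous.tendsto _).comp hlim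
  obtain rfl : (fun k => smoothData Ω (φ k) (hφ k)) = z := funext hzφ
  exact ⟨φ, hφ,
    (tendsto_toLp_iff (fun k => Continuous.memLp_vol Ω (hφ k).continuous) u.fn).1 hlim1,
    (tendsto_toLp_iff
      (fun k => Continuous.memLp_vol Ω (continuous_cgrad (hφ k))) u.grad).1 hlim2,
    (tendsto_toLp_iff (fun k => Continuous.memLp_surf Ω (hφ k).continuous) t).1 hlim3⟩

theorem integral_smooth_mul_fderiv {ψ : EuclideanSpace ℝ (Fin n) → ℂ} (hψ : ContDiff ℝ ∞ ψ)
    {φ : EuclideanSpace ℝ (Fin n) → ℝ} (hφ : ContDiff ℝ ∞ φ) (hc : HasCompactSupport φ)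
    (hs : tsupport φ ⊆ Ω.carrier) (i : Fin n) :
    ∫ x, ψ x * ((fderiv ℝ φ x (EuclideanSpace.single i 1) : ℝ) : ℂ) ∂Ω.vol
      = - ∫ x, cgrad ψ x i * ((φ x : ℝ) : ℂ) ∂Ω.vol := by
  have hzero : ∀ x, x ∉ Ω.carrier → φ x = 0 := fun x hx =>
    image_eq_zero_of_notMem_tsupport fun h => hx (hs h)
  have hzero' : ∀ x, x ∉ Ω.carrier → fderiv ℝ φ x = 0 := fun x hx =>
    image_eq_zero_of_notMem_tsupport fun h => hx (hs (tsupport_fderiv_subset ℝ h))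
  -- Both integrands vanish off Ω, so integration by parts can be done on the whole space, with no
  -- boundary term.
  rw [setIntegral_eq_integral_of_forall_compl_eq_zero (fun x hx => by simp [hzero' x hx]),
    setIntegral_eq_integral_of_forall_compl_eq_zero (fun x hx => by simp [hzero x hx])]
  have hφd : Continuous (fderiv ℝ φ) := hφ.continuous_fderiv (by simp)
  have hψd : Continuous (fderiv ℝ ψ) := hψ.continuous_fderiv (by simp)
  have hφc := hφ.continuous
  have hψc := hψ.continuous
  have hofReal : ∀ x, fderiv ℝ (fun x => ((φ x : ℝ) : ℂ)) x (EuclideanSpace.single i 1) =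
      ((fderiv ℝ φ x (EuclideanSpace.single i 1) : ℝ) : ℂ) := fun x => by
    have h := (Complex.ofRealCLM.hasFDerivAt.comp x
      (hφ.differentiable (by simp) x).hasFDerivAt).fderiv
    exact congrArg (fun L => L (EuclideanSpace.single i 1)) h
  have hcs : HasCompactSupport fun x => ((φ x : ℝ) : ℂ) := hc.comp_left (g := Complex.ofReal) rfl
  have hcd : HasCompactSupport fun x =>
      ((fderiv ℝ φ x (EuclideanSpace.single i 1) : ℝ) : ℂ) :=
    (hc.fderiv ℝ).comp_left (g := fun L : EuclideanSpace ℝ (Fin n) →L[ℝ] ℝ =>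
      ((L (EuclideanSpace.single i 1) : ℝ) : ℂ))
      (by simp)
  have hdiff : Differentiable ℝ fun x => ((φ x : ℝ) : ℂ) :=
    Complex.ofRealCLM.differentiable.comp (hφ.differentiable (by simp))
  have h := integral_mul_fderiv_eq_neg_fderiv_mul_of_integrable (μ := volume) (f := ψ)
    (g := fun x => ((φ x : ℝ) : ℂ)) (v := EuclideanSpace.single i 1)
    (Continuous.integrable_of_hasCompactSupport (by fun_prop) hcs.mul_left)
    (by
      simp_rw [hofReal]
      exact Continuous.integrable_of_hasCompactSupport (by fun_prop) hcd.mul_left)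
    (Continuous.integrable_of_hasCompactSupport (by fun_prop) hcs.mul_left)
    (fun x _ => hψ.differentiable (by simp) x) (fun x _ => hdiff x)
  simp_rw [hofReal] at h
  exact h

/-- Both sides are inner products with fixed L² functions, so the identity is a closed condition and
need only be checked for smooth functions. -/
theorem weak_grad_of_mem_sobolev {z : TraceSpace Ω} (hz : z ∈ sobolev Ω)
    (φ : EuclideanSpace ℝ (Fin n) → ℝ) (hφ : ContDiff ℝ ∞ φ) (hc : HasCompactSupport φ)
    (hs : tsupport φ ⊆ Ω.carrier) (i : Fin n) :
    ∫ x, valL Ω z x * ((fderiv ℝ φ x (EuclideanSpace.single i 1) : ℝ) : ℂ) ∂Ω.vol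
      = - ∫ x, gradL Ω z x i * ((φ x : ℝ) : ℂ) ∂Ω.vol := by
  have hφd : Continuous (fderiv ℝ φ) := hφ.continuous_fderiv (by simp)
  have hφc := hφ.continuous
  have ha : Continuous fun x => ((fderiv ℝ φ x (EuclideanSpace.single i 1) : ℝ) : ℂ) := by
    fun_prop
  have hb : Continuous fun x => EuclideanSpace.single i ((φ x : ℝ) : ℂ) := by
    simp_rw [EuclideanSpace.single]
    refine (PiLp.continuous_toLp 2 _).comp ?_
    exact (continuous_single i).comp (by fun_prop)
  set a := (Continuous.memLp_vol Ω ha).toLp with hadef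
  set b := (Continuous.memLp_vol Ω hb).toLp with hbdef
  have h1 : ∀ f : Lp ℂ 2 Ω.vol, inner ℂ a f =
      ∫ x, f x * ((fderiv ℝ φ x (EuclideanSpace.single i 1) : ℝ) : ℂ) ∂Ω.vol := by
    intro f
    rw [L2.inner_def]
    refine integral_congr_ae ?_
    filter_upwards [(Continuous.memLp_vol Ω ha).coeFn_toLp] with x hx
    rw [hx]
    simp
  have h2 : ∀ G : Lp (EuclideanSpace ℂ (Fin n)) 2 Ω.vol, inner ℂ b G =
      ∫ x, G x i * ((φ x : ℝ) : ℂ) ∂Ω.vol := by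
    intro G
    rw [L2.inner_def]
    refine integral_congr_ae ?_
    filter_upwards [(Continuous.memLp_vol Ω hb).coeFn_toLp] with x hx
    rw [hx, EuclideanSpace.inner_single_left]
    simp [mul_comm]
  rw [← h1, ← h2]
  have hcl : IsClosed {z : TraceSpace Ω | inner ℂ a (valL Ω z) = -inner ℂ b (gradL Ω z)} :=
    isClosed_eq (by fun_prop) (by fun_prop)
  refine closure_minimal ?_ hcl hz
  rintro _ ⟨ψ, hψ, rfl⟩
  simp only [Set.mem_ofPred_eq]
  rw [h1, h2]
  refine Eq.trans (integral_congr_ae ?_)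
    ((integral_smooth_mul_fderiv hψ hφ hc hs i).trans (congrArg _ (integral_congr_ae ?_)))
  · filter_upwards [(Continuous.memLp_vol Ω hψ.continuous).coeFn_toLp] with x hx
    rw [smoothData, valL_traceData, hx]
  · filter_upwards [(Continuous.memLp_vol Ω (continuous_cgrad hψ)).coeFn_toLp] with x hx
    rw [smoothData, gradL_traceData, hx]

/-- The element of `H¹(Ω)` underlying a triple in `sobolev Ω`. -/
def H1.ofSobolev (z : TraceSpace Ω) (hz : z ∈ sobolev Ω) : H1 Ω where
  fn := valL Ω z
  grad := gradL Ω z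
  weak_grad := weak_grad_of_mem_sobolev hz

theorem H1.hasTrace_ofSobolev (z : TraceSpace Ω) (hz : z ∈ sobolev Ω) :
    (H1.ofSobolev z hz).HasTrace (trL Ω z) :=
  H1.hasTrace_of_mem_sobolev hz

/-! ### Control of the norm by the gradient and the boundary mean. -/

theorem norm_toLp_sq {α F : Type*} [MeasurableSpace α] {μ : Measure α} [NormedAddCommGroup F]
    {f : α → F} (hf : MemLp f 2 μ) :
    ENNReal.ofReal (‖hf.toLp f‖ ^ 2) = ∫⁻ x, ‖f x‖ₑ ^ 2 ∂μ := by
  rw [ENNReal.ofReal_pow (norm_nonneg _), ofReal_norm, Lp.enorm_toLp,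
    eLpNorm_eq_lintegral_rpow_enorm_toReal two_ne_zero ENNReal.ofNat_ne_top,
    ← ENNReal.rpow_natCast, ← ENNReal.rpow_mul]
  norm_num

theorem cgrad_sub_const (φ : EuclideanSpace ℝ (Fin n) → ℂ) (c : ℂ) :
    cgrad (fun x => φ x - c) = cgrad φ := by
  ext x i
  simp [cgrad, fderiv_sub_const]

/-- The triple of the constant function `1`. -/
def oneData (Ω : LipschitzDomain n) : TraceSpace Ω := smoothData Ω (fun _ => 1) contDiff_const

theorem oneData_mem_sobolev : oneData Ω ∈ sobolev Ω := smoothData_mem_sobolev _ _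

theorem gradL_oneData : gradL Ω (oneData Ω) = 0 := by
  simp only [oneData, smoothData, gradL_traceData, cgrad_const]
  rfl

theorem coeFn_trL_oneData : trL Ω (oneData Ω) =ᵐ[Ω.surf] fun _ => 1 :=
  (Continuous.memLp_surf Ω (continuous_const (y := (1 : ℂ)))).coeFn_toLp

theorem inner_trL_oneData (t : Lp ℂ 2 Ω.surf) :
    inner ℂ (trL Ω (oneData Ω)) t = ∫ x, t x ∂Ω.surf := by
  rw [L2.inner_def]
  refine integral_congr_ae ?_
  filter_upwards [coeFn_trL_oneData (Ω := Ω)] with x hx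
  rw [hx]
  simp

theorem mem_L2Diamond_iff (t : Lp ℂ 2 Ω.surf) :
    t ∈ L2Diamond Ω ↔ inner ℂ (trL Ω (oneData Ω)) t = 0 := by
  rw [inner_trL_oneData]
  rfl

theorem smoothData_sub_smul_oneData {φ : EuclideanSpace ℝ (Fin n) → ℂ} (hφ : ContDiff ℝ ∞ φ)
    (c : ℂ) : smoothData Ω φ hφ - c • oneData Ω =
      smoothData Ω (fun x => φ x - c) (hφ.sub contDiff_const) := by
  have h1 : c • oneData Ω = smoothData Ω (fun _ => c) contDiff_const := by
    have hc : (fun _ : EuclideanSpace ℝ (Fin n) => c) = c • fun _ => (1 : ℂ) := by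
      ext; simp
    simp only [oneData, smoothData, hc, cgrad_const_smul contDiff_const]
    rfl
  have h2 : cgrad (fun x => φ x - c) =
      cgrad φ - cgrad (fun _ : EuclideanSpace ℝ (Fin n) => c) := by
    rw [cgrad_sub_const, cgrad_const, sub_zero]
  rw [h1]
  simp only [smoothData, h2]
  rfl

/-- Poincaré's inequality for the `L²` norms in `Ω` and on the boundary. -/
theorem exists_norm_sub_const_le (Ω : LipschitzDomain n) :
    ∃ D : ℝ, 0 ≤ D ∧ ∀ z ∈ smoothSubmodule Ω, ∃ c : ℂ,
      ‖valL Ω (z - c • oneData Ω)‖ ≤ D * ‖gradL Ω z‖ ∧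
      ‖trL Ω (z - c • oneData Ω)‖ ≤ D * ‖gradL Ω z‖ := by
  obtain ⟨C, hC⟩ := isPoincare_bulk Ω
  refine ⟨√C, Real.sqrt_nonneg _, ?_⟩
  rintro _ ⟨φ, hφ, rfl⟩
  obtain ⟨c, hc⟩ := hC φ hφ
  refine ⟨c, ?_⟩
  have hφc : ContDiff ℝ ∞ fun x => φ x - c := hφ.sub contDiff_const
  rw [smoothData_sub_smul_oneData hφ]
  simp only [smoothData, valL_traceData, trL_traceData, gradL_traceData]
  rw [LipschitzDomain.bulk, lintegral_add_measure,
    ← norm_toLp_sq (Continuous.memLp_vol Ω hφc.continuous),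
    ← norm_toLp_sq (Continuous.memLp_surf Ω hφc.continuous),
    ← norm_toLp_sq (Continuous.memLp_vol Ω (continuous_cgrad hφ)),
    ← ENNReal.ofReal_coe_nnreal, ← ENNReal.ofReal_add (by positivity) (by positivity),
    ← ENNReal.ofReal_mul (by positivity), ENNReal.ofReal_le_ofReal_iff (by positivity)] at hc
  have hsq : (√C : ℝ) ^ 2 = C := Real.sq_sqrt C.2
  constructor <;>
  · refine (pow_le_pow_iff_left₀ (norm_nonneg _) (by positivity) two_ne_zero).1 ?_
    rw [mul_pow, hsq]
    refine le_trans ?_ hc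
    simp only [le_add_iff_nonneg_right, le_add_iff_nonneg_left]
    positivity

/-- The gradient and the boundary mean control the full norm. -/
theorem exists_norm_le_gradL_add_mean (hs : trL Ω (oneData Ω) ≠ 0) :
    ∃ K : ℝ, 0 < K ∧ ∀ z ∈ sobolev Ω,
      ‖z‖ ≤ K * (‖gradL Ω z‖ + ‖inner ℂ (trL Ω (oneData Ω)) (trL Ω z)‖) := by
  obtain ⟨D, hD, hP⟩ := exists_norm_sub_const_le Ω
  set a := ‖trL Ω (oneData Ω)‖ with ha
  set b := ‖valL Ω (oneData Ω)‖ with hb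
  have ha0 : 0 < a := norm_pos_iff.2 hs
  have hb0 : 0 ≤ b := norm_nonneg _
  refine ⟨1 + 2 * D + (b + a) * (a * D) / a ^ 2 + (b + a) / a ^ 2, by positivity, ?_⟩
  -- The estimate is a closed condition, so smooth triples suffice.
  have hcl : IsClosed {z : TraceSpace Ω | ‖z‖ ≤
      (1 + 2 * D + (b + a) * (a * D) / a ^ 2 + (b + a) / a ^ 2) *
        (‖gradL Ω z‖ + ‖inner ℂ (trL Ω (oneData Ω)) (trL Ω z)‖)} :=
    isClosed_le (by fun_prop) (by fun_prop)
  refine fun z hz => closure_minimal (fun z hz => ?_) hcl hz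
  obtain ⟨c, hv, ht⟩ := hP z hz
  rw [Set.mem_ofPred_eq]
  set m := inner ℂ (trL Ω (oneData Ω)) (trL Ω z) with hm
  set g := ‖gradL Ω z‖ with hg
  have hg0 : 0 ≤ g := norm_nonneg _
  -- Pairing with 1 on the boundary isolates c: its multiple a² c differs from the mean m by a term
  -- controlled by the gradient.
  have hin : inner ℂ (trL Ω (oneData Ω)) (trL Ω (z - c • oneData Ω)) = m - c * (a : ℂ) ^ 2 := by
    rw [map_sub, map_smul, inner_sub_right, inner_smul_right, inner_self_eq_norm_sq_to_K]
    rfl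
  have hc : ‖c‖ ≤ (‖m‖ + a * (D * g)) / a ^ 2 := by
    rw [le_div_iff₀ (by positivity)]
    have h1 : ‖m - c * (a : ℂ) ^ 2‖ ≤ a * (D * g) := by
      rw [← hin]
      exact (norm_inner_le_norm _ _).trans (mul_le_mul_of_nonneg_left ht ha0.le)
    have h2 : ‖c * (a : ℂ) ^ 2‖ = ‖c‖ * a ^ 2 := by
      rw [norm_mul, norm_pow, Complex.norm_real, Real.norm_of_nonneg ha0.le]
    have h3 := norm_sub_norm_le (c * (a : ℂ) ^ 2) m
    rw [norm_sub_rev] at h3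
    linarith
  have hv' : ‖valL Ω z‖ ≤ D * g + ‖c‖ * b := by
    have h := norm_add_le (valL Ω (z - c • oneData Ω)) (valL Ω (c • oneData Ω))
    rw [← map_add, sub_add_cancel, map_smul, norm_smul] at h
    linarith
  have ht' : ‖trL Ω z‖ ≤ D * g + ‖c‖ * a := by
    have h := norm_add_le (trL Ω (z - c • oneData Ω)) (trL Ω (c • oneData Ω))
    rw [← map_add, sub_add_cancel, map_smul, norm_smul] at h
    linarith
  calc ‖z‖ ≤ ‖valL Ω z‖ + g + ‖trL Ω z‖ := TraceSpace.norm_le z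
    _ ≤ (1 + 2 * D) * g + (b + a) * ‖c‖ := by linarith
    _ ≤ (1 + 2 * D) * g + (b + a) * ((‖m‖ + a * (D * g)) / a ^ 2) := by gcongr
    _ = (1 + 2 * D + (b + a) * (a * D) / a ^ 2) * g + (b + a) / a ^ 2 * ‖m‖ := by ring
    _ ≤ (1 + 2 * D + (b + a) * (a * D) / a ^ 2 + (b + a) / a ^ 2) * g +
        (1 + 2 * D + (b + a) * (a * D) / a ^ 2 + (b + a) / a ^ 2) * ‖m‖ :=
      add_le_add
        (mul_le_mul_of_nonneg_right (le_add_of_nonneg_right (by positivity)) hg0)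
        (mul_le_mul_of_nonneg_right (le_add_of_nonneg_left (by positivity)) (norm_nonneg _))
    _ = _ := by ring

/-! ### The coercive form and Lax–Milgram. -/

/-- Multiplication by an admittivity. -/
def mulL (γ : EuclideanSpace ℝ (Fin n) → ℂ) (hγ : MemLp γ ⊤ Ω.vol) :
    Lp (EuclideanSpace ℂ (Fin n)) 2 Ω.vol →L[ℂ] Lp (EuclideanSpace ℂ (Fin n)) 2 Ω.vol :=
  (ContinuousLinearMap.lsmul ℂ ℂ).holderL Ω.vol ⊤ 2 2 hγ.toLp

theorem coeFn_mulL {γ : EuclideanSpace ℝ (Fin n) → ℂ} (hγ : MemLp γ ⊤ Ω.vol)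
    (G : Lp (EuclideanSpace ℂ (Fin n)) 2 Ω.vol) :
    mulL γ hγ G =ᵐ[Ω.vol] fun x => γ x • G x := by
  filter_upwards [ContinuousLinearMap.coeFn_holder (r := 2) (ContinuousLinearMap.lsmul ℂ ℂ)
    hγ.toLp G, hγ.coeFn_toLp] with x hx hx'
  rw [mulL, ContinuousLinearMap.holderL_apply_apply, hx, hx']
  rfl

theorem inner_mulL {γ : EuclideanSpace ℝ (Fin n) → ℂ} (hγ : MemLp γ ⊤ Ω.vol)
    (F G : Lp (EuclideanSpace ℂ (Fin n)) 2 Ω.vol) :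
    inner ℂ F (mulL γ hγ G) =
      ∫ x, γ x * ∑ i, G x i * (starRingEnd ℂ) (F x i) ∂Ω.vol := by
  rw [L2.inner_def]
  refine integral_congr_ae ?_
  filter_upwards [coeFn_mulL hγ G] with x hx
  rw [hx, inner_smul_right, PiLp.inner_apply]
  rfl

theorem mul_norm_sq_le_re_inner_mulL {γ : EuclideanSpace ℝ (Fin n) → ℂ} (hγ : MemLp γ ⊤ Ω.vol)
    {c : ℝ} (hc : ∀ᵐ x ∂Ω.vol, c ≤ (γ x).re) (G : Lp (EuclideanSpace ℂ (Fin n)) 2 Ω.vol) :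
    c * ‖G‖ ^ 2 ≤ (inner ℂ G (mulL γ hγ G)).re := by
  have h1 : ‖G‖ ^ 2 = ∫ x, ‖G x‖ ^ 2 ∂Ω.vol := by
    have h := L2.inner_def (𝕜 := ℂ) G G
    simp_rw [inner_self_eq_norm_sq_to_K] at h
    have h' : ((‖G‖ ^ 2 : ℝ) : ℂ) = ((∫ x, ‖G x‖ ^ 2 ∂Ω.vol : ℝ) : ℂ) := by
      rw [← integral_complex_ofReal]
      push_cast
      exact h
    exact_mod_cast h'
  have hi : Integrable (fun x => inner ℂ (G x) (mulL γ hγ G x)) Ω.vol :=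
    L2.integrable_inner G (mulL γ hγ G)
  have h2 : (inner ℂ G (mulL γ hγ G)).re = ∫ x, (inner ℂ (G x) (mulL γ hγ G x)).re ∂Ω.vol := by
    rw [L2.inner_def]
    exact (integral_re hi).symm
  have hGi : Integrable (fun x => ‖G x‖ ^ 2) Ω.vol := (Lp.memLp G).integrable_norm_pow two_ne_zero
  rw [h1, h2, ← integral_const_mul]
  refine integral_mono_ae (hGi.const_mul c) hi.re ?_
  filter_upwards [coeFn_mulL hγ G, hc] with x hx hcx
  simp only [hx, inner_smul_right]
  rw [inner_self_eq_norm_sq_to_K]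
  have h3 : (γ x * ((‖G x‖ : ℝ) : ℂ) ^ 2).re = (γ x).re * ‖G x‖ ^ 2 := by
    rw [← Complex.ofReal_pow, Complex.re_mul_ofReal]
  exact (mul_le_mul_of_nonneg_right hcx (by positivity)).trans_eq h3.symm

/-- `H¹_⋄(Ω)`: triples whose boundary component has vanishing mean. -/
def sobolevDiamond (Ω : LipschitzDomain n) : Submodule ℂ (TraceSpace Ω) :=
  sobolev Ω ⊓ (L2Diamond Ω).comap (trL Ω).toLinearMap

theorem isClosed_sobolevDiamond (Ω : LipschitzDomain n) :
    IsClosed (sobolevDiamond Ω : Set (TraceSpace Ω)) := by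
  have h : IsClosed (L2Diamond Ω : Set (Lp ℂ 2 Ω.surf)) := by
    rw [L2Diamond_eq_orthogonal]
    exact Submodule.isClosed_orthogonal _
  have h' := (isClosed_sobolev Ω).inter (h.preimage (trL Ω).continuous)
  exact h'

/-- Lax–Milgram for forms `⟪P w, M (P u)⟫` that are coercive. -/
theorem exists_solution_operator {H L D : Type*} [NormedAddCommGroup H] [InnerProductSpace ℂ H]
    [CompleteSpace H] [NormedAddCommGroup L] [InnerProductSpace ℂ L] [CompleteSpace L]
    [NormedAddCommGroup D] [InnerProductSpace ℂ D] [CompleteSpace D] (P : H →L[ℂ] L)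
    (Q : H →L[ℂ] D) (M : L →L[ℂ] L) {c K : ℝ} (hc : 0 < c) (hK : 0 < K)
    (hM : ∀ G, c * ‖G‖ ^ 2 ≤ (inner ℂ G (M G)).re) (hP : ∀ z, ‖z‖ ≤ K * ‖P z‖) :
    ∃ R : D →L[ℂ] H, ∀ g w, inner ℂ (P w) (M (P (R g))) = inner ℂ (Q w) g := by
  have hunit : IsUnit (ContinuousLinearMap.adjoint P ∘L M ∘L P) := by
    -- P* M P is bounded below in the form sense by c / K²; the solution operator is then (P* M P)⁻¹
    -- Q*.
    refine ContinuousLinearMap.isUnit_of_forall_le_norm_inner_map _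
      (c := (c / K ^ 2).toNNReal) (by simpa using by positivity) fun z => ?_
    rw [Real.coe_toNNReal _ (by positivity), ContinuousLinearMap.comp_apply,
      ContinuousLinearMap.adjoint_inner_left, ← inner_conj_symm, RCLike.norm_conj]
    calc ‖z‖ ^ 2 * (c / K ^ 2) ≤ (K * ‖P z‖) ^ 2 * (c / K ^ 2) := by
          gcongr
          exact hP z
      _ = c * ‖P z‖ ^ 2 := by field_simp
      _ ≤ _ := hM _
      _ ≤ _ := Complex.re_le_norm _
  obtain ⟨A, hA⟩ := hunit
  refine ⟨(↑A⁻¹ : H →L[ℂ] H) ∘L ContinuousLinearMap.adjoint Q, fun g w => ?_⟩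
  have hAR : ∀ y, (ContinuousLinearMap.adjoint P ∘L M ∘L P) ((↑A⁻¹ : H →L[ℂ] H) y) = y := by
    intro y
    have h : (ContinuousLinearMap.adjoint P ∘L M ∘L P) * (↑A⁻¹ : H →L[ℂ] H) = 1 := by
      rw [← hA, Units.mul_inv]
    exact congrArg (fun L => L y) h
  rw [← ContinuousLinearMap.adjoint_inner_right, ← ContinuousLinearMap.adjoint_inner_right]
  exact congrArg (inner ℂ w) (hAR _)

/-- Lax–Milgram on a closed subspace. -/
theorem exists_solution_operator_of_isClosed {H L D : Type*} [NormedAddCommGroup H]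
    [InnerProductSpace ℂ H] [CompleteSpace H] [NormedAddCommGroup L] [InnerProductSpace ℂ L]
    [CompleteSpace L] [NormedAddCommGroup D] [InnerProductSpace ℂ D] [CompleteSpace D]
    {S : Submodule ℂ H} (hS : IsClosed (S : Set H)) (P : H →L[ℂ] L)
    (Q : H →L[ℂ] D) (M : L →L[ℂ] L) {c K : ℝ} (hc : 0 < c) (hK : 0 < K)
    (hM : ∀ G, c * ‖G‖ ^ 2 ≤ (inner ℂ G (M G)).re) (hP : ∀ z ∈ S, ‖z‖ ≤ K * ‖P z‖) :
    ∃ R : D →L[ℂ] H, (∀ g, R g ∈ S) ∧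
      ∀ g, ∀ w ∈ S, inner ℂ (P w) (M (P (R g))) = inner ℂ (Q w) g := by
  have : CompleteSpace S := hS.completeSpace_coe
  obtain ⟨R, hR⟩ := exists_solution_operator (P ∘L S.subtypeL) (Q ∘L S.subtypeL) M hc hK hM
    fun z => hP z z.2
  exact ⟨S.subtypeL ∘L R, fun g => (R g).2, fun g w hw => hR g ⟨w, hw⟩⟩

/-! ### Conjugation, linking the bilinear weak form to the sesquilinear inner product. -/

/-- Entrywise complex conjugation. -/
def cconj (z : EuclideanSpace ℂ (Fin n)) : EuclideanSpace ℂ (Fin n) :=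
  WithLp.toLp 2 fun i => (starRingEnd ℂ) (z i)

theorem norm_cconj (z : EuclideanSpace ℂ (Fin n)) : ‖cconj z‖ = ‖z‖ := by
  simp [cconj, EuclideanSpace.norm_eq]

theorem continuous_cconj : Continuous (cconj : EuclideanSpace ℂ (Fin n) → _) := by
  unfold cconj
  fun_prop

theorem cconj_sub (z w : EuclideanSpace ℂ (Fin n)) : cconj (z - w) = cconj z - cconj w := by
  ext i
  simp [cconj]

theorem memLp_conj {μ : Measure (EuclideanSpace ℝ (Fin n))} (f : Lp ℂ 2 μ) :
    MemLp (fun x => (starRingEnd ℂ) (f x)) 2 μ :=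
  (Lp.memLp f).congr_norm (Complex.continuous_conj.comp_aestronglyMeasurable
    (Lp.aestronglyMeasurable f)) (Eventually.of_forall fun _ => by simp)

theorem memLp_cconj {μ : Measure (EuclideanSpace ℝ (Fin n))}
    (f : Lp (EuclideanSpace ℂ (Fin n)) 2 μ) : MemLp (fun x => cconj (f x)) 2 μ :=
  (Lp.memLp f).congr_norm (continuous_cconj.comp_aestronglyMeasurable
    (Lp.aestronglyMeasurable f)) (Eventually.of_forall fun _ => (norm_cconj _).symm)

/-- The complex conjugate of an `H¹` function. -/
def H1.conj (u : H1 Ω) : H1 Ω where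
  fn := (memLp_conj u.fn).toLp
  grad := (memLp_cconj u.grad).toLp
  weak_grad := by
    intro φ hφ hc hs i
    have h := congrArg (starRingEnd ℂ) (u.weak_grad φ hφ hc hs i)
    rw [map_neg, ← integral_conj, ← integral_conj] at h
    refine Eq.trans (integral_congr_ae ?_) (h.trans (congrArg _ (integral_congr_ae ?_)))
    · filter_upwards [(memLp_conj u.fn).coeFn_toLp] with x hx
      rw [hx]
      simp
    · filter_upwards [(memLp_cconj u.grad).coeFn_toLp] with x hx
      rw [hx]
      simp [cconj]

theorem cgrad_conj {φ : EuclideanSpace ℝ (Fin n) → ℂ} (hφ : ContDiff ℝ ∞ φ)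
    (x : EuclideanSpace ℝ (Fin n)) :
    cgrad (fun y => (starRingEnd ℂ) (φ y)) x = cconj (cgrad φ x) := by
  have h := (Complex.conjCLE.toContinuousLinearMap.hasFDerivAt.comp x
    (hφ.differentiable (by simp) x).hasFDerivAt).fderiv
  ext i
  exact congrArg (fun L => L (EuclideanSpace.single i 1)) h

theorem H1.HasTrace.conj {u : H1 Ω} {t : Lp ℂ 2 Ω.surf} (h : u.HasTrace t) :
    u.conj.HasTrace (memLp_conj t).toLp := by
  obtain ⟨φ, hφ, h1, h2, h3⟩ := h
  refine ⟨fun k x => (starRingEnd ℂ) (φ k x), fun k => Complex.conjCLE.contDiff.comp (hφ k),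
    ?_, ?_, ?_⟩
  · refine h1.congr fun k => eLpNorm_congr_norm_ae ?_
    filter_upwards [(memLp_conj u.fn).coeFn_toLp] with x hx
    rw [H1.conj, hx, ← map_sub, RCLike.norm_conj]
  · refine h2.congr fun k => eLpNorm_congr_norm_ae ?_
    filter_upwards [(memLp_cconj u.grad).coeFn_toLp] with x hx
    rw [H1.conj, hx, cgrad_conj (hφ k), ← cconj_sub, norm_cconj]
  · refine h3.congr fun k => eLpNorm_congr_norm_ae ?_
    filter_upwards [(memLp_conj t).coeFn_toLp] with x hx
    rw [hx, ← map_sub, RCLike.norm_conj]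

theorem inner_toLp_conj {μ : Measure (EuclideanSpace ℝ (Fin n))} (s g : Lp ℂ 2 μ) :
    inner ℂ (memLp_conj s).toLp g = ∫ x, g x * s x ∂μ := by
  rw [L2.inner_def]
  refine integral_congr_ae ?_
  filter_upwards [(memLp_conj s).coeFn_toLp] with x hx
  rw [hx]
  simp

theorem inner_conj_grad_mulL {γ : EuclideanSpace ℝ (Fin n) → ℂ} (hγ : MemLp γ ⊤ Ω.vol)
    (v : H1 Ω) (G : Lp (EuclideanSpace ℂ (Fin n)) 2 Ω.vol) :
    inner ℂ v.conj.grad (mulL γ hγ G) = ∫ x, γ x * ∑ i, G x i * v.grad x i ∂Ω.vol := by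
  rw [inner_mulL]
  refine integral_congr_ae ?_
  filter_upwards [(memLp_cconj v.grad).coeFn_toLp] with x hx
  rw [H1.conj, hx]
  simp [cconj]

/-! ### Existence of the Neumann-to-Dirichlet operator. -/

theorem exists_solution_of_ne_zero (hs : trL Ω (oneData Ω) ≠ 0)
    {γ : EuclideanSpace ℝ (Fin n) → ℂ} (hγ : IsAdmittivity Ω γ) :
    ∃ R : Lp ℂ 2 Ω.surf →L[ℂ] TraceSpace Ω, (∀ g, R g ∈ sobolevDiamond Ω) ∧
      ∀ g, ∀ w ∈ sobolevDiamond Ω,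
        inner ℂ (gradL Ω w) (mulL γ hγ.1 (gradL Ω (R g))) = inner ℂ (trL Ω w) g := by
  obtain ⟨c, hc0, hc⟩ := hγ.2
  obtain ⟨K, hK, hKz⟩ := exists_norm_le_gradL_add_mean hs
  refine exists_solution_operator_of_isClosed (isClosed_sobolevDiamond Ω) (gradL Ω) (trL Ω)
    (mulL γ hγ.1) hc0 hK (mul_norm_sq_le_re_inner_mulL hγ.1 hc) fun z hz => ?_
  have h := hKz z hz.1
  have h0 : inner ℂ (trL Ω (oneData Ω)) (trL Ω z) = 0 := (mem_L2Diamond_iff _).1 hz.2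
  rw [h0, norm_zero, add_zero] at h
  exact h

theorem exists_sub_smul_oneData_mem_sobolevDiamond (hs : trL Ω (oneData Ω) ≠ 0) {z : TraceSpace Ω}
    (hz : z ∈ sobolev Ω) : ∃ m : ℂ, z - m • oneData Ω ∈ sobolevDiamond Ω := by
  refine ⟨inner ℂ (trL Ω (oneData Ω)) (trL Ω z) /
    inner ℂ (trL Ω (oneData Ω)) (trL Ω (oneData Ω)),
    Submodule.sub_mem _ hz (Submodule.smul_mem _ _ oneData_mem_sobolev), ?_⟩
  change trL Ω (z - _ • oneData Ω) ∈ L2Diamond Ω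
  rw [mem_L2Diamond_iff, map_sub, map_smul, inner_sub_right, inner_smul_right,
    div_mul_cancel₀ _ (inner_self_ne_zero.2 hs), sub_self]

/-- A weak equation tested on `H¹_⋄(Ω)` holds for all test functions. -/
theorem inner_gradL_eq_of_diamond (hs : trL Ω (oneData Ω) ≠ 0) {g : Lp ℂ 2 Ω.surf}
    (hg : g ∈ L2Diamond Ω) {F : Lp (EuclideanSpace ℂ (Fin n)) 2 Ω.vol}
    (h : ∀ w ∈ sobolevDiamond Ω, inner ℂ (gradL Ω w) F = inner ℂ (trL Ω w) g)
    {z : TraceSpace Ω} (hz : z ∈ sobolev Ω) :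
    inner ℂ (gradL Ω z) F = inner ℂ (trL Ω z) g := by
  -- Removing a constant changes neither side: it has zero gradient, and g has zero mean.
  obtain ⟨m, hm⟩ := exists_sub_smul_oneData_mem_sobolevDiamond hs hz
  have hw := h _ hm
  rw [map_sub, map_sub, map_smul, map_smul, gradL_oneData, smul_zero, sub_zero, inner_sub_left,
    inner_smul_left, (mem_L2Diamond_iff _).1 hg, mul_zero, sub_zero] at hw
  exact hw

theorem exists_isNtD_of_ne_zero (hs : trL Ω (oneData Ω) ≠ 0)
    {γ : EuclideanSpace ℝ (Fin n) → ℂ} (hγ : IsAdmittivity Ω γ) :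
    ∃ T : L2Diamond Ω →L[ℂ] L2Diamond Ω, IsNtD Ω γ T := by
  obtain ⟨R, hRS, hR⟩ := exists_solution_of_ne_zero hs hγ
  refine ⟨(trL Ω ∘L R ∘L (L2Diamond Ω).subtypeL).codRestrict (L2Diamond Ω)
    fun g => (hRS g).2, fun g => ?_⟩
  have htr : (H1.ofSobolev _ (hRS g).1).HasTrace (trL Ω (R g)) := H1.hasTrace_ofSobolev _ _
  refine ⟨H1.ofSobolev _ (hRS g).1, ⟨⟨_, (hRS g).2, htr⟩, fun v s hv => ?_⟩, htr⟩
  have hw := inner_gradL_eq_of_diamond hs g.2 (hR g) hv.conj.mem_sobolev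
  rw [gradL_traceData, trL_traceData, inner_conj_grad_mulL, inner_toLp_conj] at hw
  exact hw

/-- If 1 has zero trace, the surface measure vanishes; all boundary integrals are then 0 and u = 0
is a solution. -/
theorem isNtD_zero_of_eq_zero (hs : trL Ω (oneData Ω) = 0)
    (γ : EuclideanSpace ℝ (Fin n) → ℂ) : IsNtD Ω γ 0 := by
  have hsurf : Ω.surf = 0 := by
    have h1 := coeFn_trL_oneData (Ω := Ω)
    rw [hs] at h1
    have h2 : ∀ᵐ _ ∂Ω.surf, False := by
      filter_upwards [h1, Lp.coeFn_zero ℂ 2 Ω.surf] with x hx hx'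
      rw [hx'] at hx
      simp at hx
    rw [Filter.eventually_false_iff_eq_bot, ae_eq_bot] at h2
    exact h2
  intro g
  have htr := H1.hasTrace_ofSobolev (0 : TraceSpace Ω) (Submodule.zero_mem _)
  rw [map_zero] at htr
  refine ⟨H1.ofSobolev 0 (Submodule.zero_mem _), ⟨⟨0, Submodule.zero_mem _, htr⟩, ?_⟩, htr⟩
  intro v s _
  have hgrad : (H1.ofSobolev (0 : TraceSpace Ω) (Submodule.zero_mem _)).grad = 0 := map_zero _
  have hr : ∫ x, (g : Lp ℂ 2 Ω.surf) x * s x ∂Ω.surf = 0 := by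
    have h : ∀ f : EuclideanSpace ℝ (Fin n) → ℂ, ∫ x, f x ∂Ω.surf = 0 := fun f => by
      rw [hsurf, integral_zero_measure]
    exact h _
  rw [hr]
  refine integral_eq_zero_of_ae ?_
  filter_upwards [Lp.coeFn_zero (EuclideanSpace ℂ (Fin n)) 2 Ω.vol] with x hx
  rw [hgrad, hx]
  simp

/-- Admittivities have a bounded Neumann-to-Dirichlet operator. -/
theorem isNtD_NtD {γ : EuclideanSpace ℝ (Fin n) → ℂ} (hγ : IsAdmittivity Ω γ) :
    IsNtD Ω γ (NtD Ω γ) := by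
  have h : ∃ T : L2Diamond Ω →L[ℂ] L2Diamond Ω, IsNtD Ω γ T := by
    by_cases hs : trL Ω (oneData Ω) = 0
    · exact ⟨0, isNtD_zero_of_eq_zero hs γ⟩
    · exact exists_isNtD_of_ne_zero hs hγ
  rw [NtD, dif_pos h]
  exact h.choose_spec

/-! ### Tested weak equations and the middle term. -/

theorem IsSolution.inner_grad_eq {γ : EuclideanSpace ℝ (Fin n) → ℂ} {g : L2Diamond Ω} {u : H1 Ω}
    (hu : IsSolution Ω γ g u) (hγ : MemLp γ ⊤ Ω.vol) {v : H1 Ω} {s : Lp ℂ 2 Ω.surf}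
    (hv : v.HasTrace s) :
    inner ℂ v.grad (mulL γ hγ u.grad) = inner ℂ s (g : Lp ℂ 2 Ω.surf) := by
  have h := hu.2 v.conj _ hv.conj
  rw [inner_mulL, L2.inner_def]
  refine Eq.trans (integral_congr_ae ?_) (h.trans (integral_congr_ae ?_))
  · filter_upwards [(memLp_cconj v.grad).coeFn_toLp] with x hx
    rw [H1.conj, hx]
    rfl
  · filter_upwards [(memLp_conj s).coeFn_toLp] with x hx
    rw [hx]
    simp

/-- Testing both equations with u and with v makes the form vanish at the difference of gradients,
and coercivity in the gradient concludes. No Poincaré inequality is needed. -/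
theorem IsSolution.grad_unique {γ : EuclideanSpace ℝ (Fin n) → ℂ} (hγ : IsAdmittivity Ω γ)
    {g : L2Diamond Ω} {u v : H1 Ω} (hu : IsSolution Ω γ g u) (hv : IsSolution Ω γ g v) :
    u.grad = v.grad := by
  obtain ⟨hγ', c, hc0, hc⟩ := hγ
  obtain ⟨t, -, ht⟩ := hu.1
  obtain ⟨s, -, hs⟩ := hv.1
  have h := mul_norm_sq_le_re_inner_mulL hγ' hc (u.grad - v.grad)
  rw [map_sub, inner_sub_left, inner_sub_right, inner_sub_right, hu.inner_grad_eq hγ' ht,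
    hv.inner_grad_eq hγ' ht, hu.inner_grad_eq hγ' hs, hv.inner_grad_eq hγ' hs, sub_self, sub_self,
    sub_self, Complex.zero_re] at h
  have h0 : ‖u.grad - v.grad‖ ^ 2 = 0 :=
    le_antisymm (nonpos_of_mul_nonpos_right h hc0) (by positivity)
  exact sub_eq_zero.1 (norm_eq_zero.1 (pow_eq_zero_iff two_ne_zero |>.1 h0))

theorem integral_conj_mul_rePart (g : L2Diamond Ω) (S T : L2Diamond Ω →L[ℂ] L2Diamond Ω) :
    ∫ x, (starRingEnd ℂ) ((g : Lp ℂ 2 Ω.surf) x)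
        * ((rePart (T - S) g : L2Diamond Ω) : Lp ℂ 2 Ω.surf) x ∂Ω.surf =
      (((inner ℂ (T g : Lp ℂ 2 Ω.surf) (g : Lp ℂ 2 Ω.surf)).re -
        (inner ℂ (S g : Lp ℂ 2 Ω.surf) (g : Lp ℂ 2 Ω.surf)).re : ℝ) : ℂ) := by
  have h1 : inner ℂ (g : Lp ℂ 2 Ω.surf) ((rePart (T - S) g : L2Diamond Ω) : Lp ℂ 2 Ω.surf) =
      ∫ x, (starRingEnd ℂ) ((g : Lp ℂ 2 Ω.surf) x)
        * ((rePart (T - S) g : L2Diamond Ω) : Lp ℂ 2 Ω.surf) x ∂Ω.surf := by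
    rw [L2.inner_def]
    refine integral_congr_ae (Eventually.of_forall fun x => ?_)
    exact mul_comm _ _
  have h2 : inner ℂ g (rePart (T - S) g) = (((inner ℂ ((T - S) g) g).re : ℝ) : ℂ) := by
    rw [rePart, smul_apply, add_apply, inner_smul_right,
      inner_add_right, ContinuousLinearMap.adjoint_inner_right, ← inner_conj_symm g,
      add_comm, Complex.add_conj]
    push_cast
    ring
  rw [← h1]
  refine h2.trans ?_
  rw [sub_apply, inner_sub_left, Complex.sub_re]
  rfl

/-! ### Pointwise Young inequality and the two integral bounds. -/

theorem integrable_mulL {γ : EuclideanSpace ℝ (Fin n) → ℂ} (hγ : MemLp γ ⊤ Ω.vol)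
    (F G : Lp (EuclideanSpace ℂ (Fin n)) 2 Ω.vol) :
    Integrable (fun x => (γ x * inner ℂ (F x) (G x)).re) Ω.vol := by
  have hi : Integrable (fun x => inner ℂ (F x) (mulL γ hγ G x)) Ω.vol :=
    L2.integrable_inner F (mulL γ hγ G)
  refine hi.re.congr ?_
  filter_upwards [coeFn_mulL hγ G] with x hx
  rw [hx, inner_smul_right]
  rfl

theorem re_inner_mulL {γ : EuclideanSpace ℝ (Fin n) → ℂ} (hγ : MemLp γ ⊤ Ω.vol)
    (F G : Lp (EuclideanSpace ℂ (Fin n)) 2 Ω.vol) :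
    (inner ℂ F (mulL γ hγ G)).re = ∫ x, (γ x * inner ℂ (F x) (G x)).re ∂Ω.vol := by
  have hi : Integrable (fun x => inner ℂ (F x) (mulL γ hγ G x)) Ω.vol :=
    L2.integrable_inner F (mulL γ hγ G)
  rw [L2.inner_def]
  refine (integral_re hi).symm.trans (integral_congr_ae ?_)
  filter_upwards [coeFn_mulL hγ G] with x hx
  rw [hx, inner_smul_right]
  rfl

theorem re_mul_inner_self (z : ℂ) (a : EuclideanSpace ℂ (Fin n)) :
    (z * inner ℂ a a).re = z.re * ‖a‖ ^ 2 := by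
  rw [inner_self_eq_norm_sq_to_K]
  change (z * ((‖a‖ : ℝ) : ℂ) ^ 2).re = _
  rw [← Complex.ofReal_pow, Complex.re_mul_ofReal]

/-- Cauchy–Schwarz and the square (p t - ‖z‖ s)² / p ≥ 0; the weight p may be put on either vector.
-/
theorem two_mul_re_mul_inner_le (z : ℂ) (a b : EuclideanSpace ℂ (Fin n)) {p : ℝ} (hp : 0 < p) :
    2 * (z * inner ℂ a b).re ≤ p * ‖b‖ ^ 2 + (z.re ^ 2 + z.im ^ 2) / p * ‖a‖ ^ 2 ∧
      2 * (z * inner ℂ a b).re ≤ p * ‖a‖ ^ 2 + (z.re ^ 2 + z.im ^ 2) / p * ‖b‖ ^ 2 := by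
  have h1 : (z * inner ℂ a b).re ≤ ‖z‖ * (‖a‖ * ‖b‖) := by
    refine (Complex.re_le_norm _).trans ?_
    rw [norm_mul]
    gcongr
    exact norm_inner_le_norm _ _
  have h2 : z.re ^ 2 + z.im ^ 2 = ‖z‖ ^ 2 := by
    rw [Complex.sq_norm, Complex.normSq_apply]
    ring
  have key : ∀ s t : ℝ, 2 * (‖z‖ * (s * t)) ≤ p * t ^ 2 + ‖z‖ ^ 2 / p * s ^ 2 := by
    intro s t
    have h3 : p * t ^ 2 + ‖z‖ ^ 2 / p * s ^ 2 - 2 * (‖z‖ * (s * t)) =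
        (p * t - ‖z‖ * s) ^ 2 / p := by
      field_simp
      ring
    have h4 : 0 ≤ (p * t - ‖z‖ * s) ^ 2 / p := by positivity
    linarith
  rw [h2]
  refine ⟨by linarith [key ‖a‖ ‖b‖], ?_⟩
  have := key ‖b‖ ‖a‖
  rw [mul_comm ‖b‖] at this
  linarith

theorem integrable_mul_norm_sq {k : EuclideanSpace ℝ (Fin n) → ℝ} (hk : MemLp k ⊤ Ω.vol)
    (G : Lp (EuclideanSpace ℂ (Fin n)) 2 Ω.vol) :
    Integrable (fun x => k x * ‖G x‖ ^ 2) Ω.vol :=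
  ((Lp.memLp G).integrable_norm_pow two_ne_zero).mul_of_top_right hk

theorem memLp_top_inv_re {γ : EuclideanSpace ℝ (Fin n) → ℂ} (hγ : IsAdmittivity Ω γ) :
    MemLp (fun x => ((γ x).re)⁻¹) ⊤ Ω.vol := by
  obtain ⟨hγ', c, hc0, hc⟩ := hγ
  refine memLp_top_of_bound hγ'.re.aestronglyMeasurable.aemeasurable.inv.aestronglyMeasurable c⁻¹ ?_
  filter_upwards [hc] with x hx
  rw [norm_inv, Real.norm_of_nonneg (hc0.le.trans hx)]
  exact inv_anti₀ hc0 hx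

/-- By `h` the difference is the integral of Re(γ₂|b|² + γ₁|a|² - 2γ₂⟪a, b⟫). Young with weight Re
γ₁ on a absorbs exactly the |a|² term and leaves Re γ₂ - |γ₂|² / Re γ₁, which is the stated weight.
-/
theorem integral_le_re_sub_re {γ₁ γ₂ : EuclideanSpace ℝ (Fin n) → ℂ} (hγ₁ : IsAdmittivity Ω γ₁)
    (hγ₂ : IsAdmittivity Ω γ₂) (a b : Lp (EuclideanSpace ℂ (Fin n)) 2 Ω.vol)
    (h : (inner ℂ a (mulL γ₂ hγ₂.1 b)).re = (inner ℂ a (mulL γ₁ hγ₁.1 a)).re) :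
    ∫ x, ((γ₂ x).re / (γ₁ x).re * (γ₁ x - γ₂ x).re - (γ₂ x).im ^ 2 / (γ₁ x).re)
        * ‖b x‖ ^ 2 ∂Ω.vol ≤
      (inner ℂ b (mulL γ₂ hγ₂.1 b)).re - (inner ℂ a (mulL γ₁ hγ₁.1 a)).re := by
  have hi := memLp_top_inv_re hγ₁
  obtain ⟨c, hc0, hc⟩ := hγ₁.2
  -- Boundedness of the weight makes its product with ‖b‖² integrable, as monotonicity of the
  -- integral requires.
  have hk : MemLp (fun x => (γ₂ x).re / (γ₁ x).re * (γ₁ x - γ₂ x).re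
      - (γ₂ x).im ^ 2 / (γ₁ x).re) ⊤ Ω.vol := by
    have h1 : MemLp (fun x => (γ₁ x - γ₂ x).re * ((γ₂ x).re * ((γ₁ x).re)⁻¹)) ⊤ Ω.vol :=
      (hi.mul (r := ⊤) hγ₂.1.re).mul (r := ⊤) (hγ₁.1.sub hγ₂.1).re
    have h2 : MemLp (fun x => (γ₂ x).im * ((γ₂ x).im * ((γ₁ x).re)⁻¹)) ⊤ Ω.vol :=
      (hi.mul (r := ⊤) hγ₂.1.im).mul (r := ⊤) hγ₂.1.im
    refine (h1.sub h2).ae_eq (Eventually.of_forall fun x => ?_)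
    simp only [Pi.sub_apply]
    ring
  have hadd : Integrable (fun x => (γ₂ x * inner ℂ (b x) (b x)).re
      + (γ₁ x * inner ℂ (a x) (a x)).re) Ω.vol :=
    (integrable_mulL hγ₂.1 b b).add (integrable_mulL hγ₁.1 a a)
  have hsum : (inner ℂ b (mulL γ₂ hγ₂.1 b)).re - (inner ℂ a (mulL γ₁ hγ₁.1 a)).re =
      ∫ x, ((γ₂ x * inner ℂ (b x) (b x)).re + (γ₁ x * inner ℂ (a x) (a x)).re
        - 2 * (γ₂ x * inner ℂ (a x) (b x)).re) ∂Ω.vol := by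
    rw [integral_sub hadd
      ((integrable_mulL hγ₂.1 a b).const_mul 2),
      integral_add (integrable_mulL hγ₂.1 b b) (integrable_mulL hγ₁.1 a a), integral_const_mul,
      ← re_inner_mulL hγ₂.1, ← re_inner_mulL hγ₁.1, ← re_inner_mulL hγ₂.1]
    linarith
  rw [hsum]
  refine integral_mono_ae (integrable_mul_norm_sq hk b)
    (hadd.sub ((integrable_mulL hγ₂.1 a b).const_mul 2)) ?_
  filter_upwards [hc] with x hx
  have hp : 0 < (γ₁ x).re := hc0.trans_le hx
  have h3 := (two_mul_re_mul_inner_le (γ₂ x) (a x) (b x) hp).2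
  rw [re_mul_inner_self, re_mul_inner_self]
  have h4 : (γ₂ x).re / (γ₁ x).re * (γ₁ x - γ₂ x).re - (γ₂ x).im ^ 2 / (γ₁ x).re =
      (γ₂ x).re - ((γ₂ x).re ^ 2 + (γ₂ x).im ^ 2) / (γ₁ x).re := by
    rw [Complex.sub_re]
    field_simp
    ring
  simp only [h4]
  linarith

/-- Here the cross term carries γ₁ instead: Young bounds 2Re(γ₁⟪b, a⟫) by Re γ₁ |a|² + |γ₁|² / Re γ₁
|b|², and again |a|² cancels. -/
theorem re_sub_re_le_integral {γ₁ γ₂ : EuclideanSpace ℝ (Fin n) → ℂ} (hγ₁ : IsAdmittivity Ω γ₁)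
    (hγ₂ : IsAdmittivity Ω γ₂) (a b : Lp (EuclideanSpace ℂ (Fin n)) 2 Ω.vol)
    (h : (inner ℂ b (mulL γ₁ hγ₁.1 a)).re = (inner ℂ b (mulL γ₂ hγ₂.1 b)).re) :
    (inner ℂ b (mulL γ₂ hγ₂.1 b)).re - (inner ℂ a (mulL γ₁ hγ₁.1 a)).re ≤
      ∫ x, ((γ₁ x - γ₂ x).re + (γ₁ x).im ^ 2 / (γ₁ x).re) * ‖b x‖ ^ 2 ∂Ω.vol := by
  have hi := memLp_top_inv_re hγ₁
  obtain ⟨c, hc0, hc⟩ := hγ₁.2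
  have hk : MemLp (fun x => (γ₁ x - γ₂ x).re + (γ₁ x).im ^ 2 / (γ₁ x).re) ⊤ Ω.vol := by
    have h2 : MemLp (fun x => (γ₁ x).im * ((γ₁ x).im * ((γ₁ x).re)⁻¹)) ⊤ Ω.vol :=
      (hi.mul (r := ⊤) hγ₁.1.im).mul (r := ⊤) hγ₁.1.im
    refine ((hγ₁.1.sub hγ₂.1).re.add h2).ae_eq (Eventually.of_forall fun x => ?_)
    simp only [Pi.add_apply, Pi.sub_apply, RCLike.re_eq_complex_re]
    ring
  have hadd : Integrable (fun x => (γ₂ x * inner ℂ (b x) (b x)).re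
      + (γ₁ x * inner ℂ (a x) (a x)).re) Ω.vol :=
    (integrable_mulL hγ₂.1 b b).add (integrable_mulL hγ₁.1 a a)
  have hsum : (inner ℂ b (mulL γ₂ hγ₂.1 b)).re - (inner ℂ a (mulL γ₁ hγ₁.1 a)).re =
      ∫ x, (2 * (γ₁ x * inner ℂ (b x) (a x)).re - ((γ₂ x * inner ℂ (b x) (b x)).re
        + (γ₁ x * inner ℂ (a x) (a x)).re)) ∂Ω.vol := by
    rw [integral_sub ((integrable_mulL hγ₁.1 b a).const_mul 2)
      hadd,
      integral_add (integrable_mulL hγ₂.1 b b) (integrable_mulL hγ₁.1 a a), integral_const_mul,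
      ← re_inner_mulL hγ₂.1, ← re_inner_mulL hγ₁.1, ← re_inner_mulL hγ₁.1]
    linarith
  rw [hsum]
  refine integral_mono_ae (((integrable_mulL hγ₁.1 b a).const_mul 2).sub hadd)
    (integrable_mul_norm_sq hk b) ?_
  filter_upwards [hc] with x hx
  have hp : 0 < (γ₁ x).re := hc0.trans_le hx
  have h3 := (two_mul_re_mul_inner_le (γ₁ x) (b x) (a x) hp).1
  rw [re_mul_inner_self, re_mul_inner_self]
  have h4 : (γ₁ x - γ₂ x).re + (γ₁ x).im ^ 2 / (γ₁ x).re =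
      ((γ₁ x).re ^ 2 + (γ₁ x).im ^ 2) / (γ₁ x).re - (γ₂ x).re := by
    rw [Complex.sub_re]
    field_simp
    ring
  simp only [h4]
  linarith

end

end EIT

theorem mainTheorem3 (n : ℕ) (hn : 2 ≤ n) (Ω : EIT.LipschitzDomain n)
    (γ₁ γ₂ : EuclideanSpace ℝ (Fin n) → ℂ)
    (hγ₁ : EIT.IsAdmittivity Ω γ₁) (hγ₂ : EIT.IsAdmittivity Ω γ₂)
    (g : EIT.L2Diamond Ω) (u₂ : EIT.H1 Ω) (hu₂ : EIT.IsSolution Ω γ₂ g u₂) :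
    ((∫ x, ((γ₂ x).re / (γ₁ x).re * (γ₁ x - γ₂ x).re - (γ₂ x).im ^ 2 / (γ₁ x).re)
          * ‖u₂.grad x‖ ^ 2 ∂Ω.vol : ℝ) : ℂ)
      ≤ ∫ x, (starRingEnd ℂ) ((g : Lp ℂ 2 Ω.surf) x)
          * ((EIT.rePart (EIT.NtD Ω γ₂ - EIT.NtD Ω γ₁) g : EIT.L2Diamond Ω) : Lp ℂ 2 Ω.surf) x
          ∂Ω.surf
    ∧ ∫ x, (starRingEnd ℂ) ((g : Lp ℂ 2 Ω.surf) x)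
          * ((EIT.rePart (EIT.NtD Ω γ₂ - EIT.NtD Ω γ₁) g : EIT.L2Diamond Ω) : Lp ℂ 2 Ω.surf) x
          ∂Ω.surf
      ≤ ((∫ x, ((γ₁ x - γ₂ x).re + (γ₁ x).im ^ 2 / (γ₁ x).re)
          * ‖u₂.grad x‖ ^ 2 ∂Ω.vol : ℝ) : ℂ) := by
  obtain ⟨u₁, hu₁, ht₁⟩ := EIT.isNtD_NtD hγ₁ g
  obtain ⟨v₂, hv₂, ht₂⟩ := EIT.isNtD_NtD hγ₂ g
  -- The given u₂ need not be the solution chosen for `NtD`; only its gradient enters, and that is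
  -- unique.
  have hgrad : v₂.grad = u₂.grad := hv₂.grad_unique hγ₂ hu₂
  -- The four pairings of the two equations with the two solutions: the right side depends only on
  -- the test function, which gives the identities needed for both bounds.
  have h11 := hu₁.inner_grad_eq hγ₁.1 ht₁
  have h21 := hu₂.inner_grad_eq hγ₂.1 ht₁
  have h12 := hu₁.inner_grad_eq hγ₁.1 ht₂
  have h22 := hu₂.inner_grad_eq hγ₂.1 ht₂
  rw [hgrad] at h12 h22
  rw [EIT.integral_conj_mul_rePart, Complex.real_le_real, Complex.real_le_real, ← h11, ← h22]
  exact ⟨EIT.integral_le_re_sub_re hγ₁ hγ₂ u₁.grad u₂.grad (by rw [h21, h11]),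
    EIT.re_sub_re_le_integral hγ₁ hγ₂ u₁.grad u₂.grad (by rw [h12, h22])⟩
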